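/- **Setting.** Let $(X,\mathscr F,\mu,T)$ be an ergodic measure preserving system, $\mu(X)=1$. For $A:X\to \mathrm{Mat}_m(\mathbb R)$ put $A^{(n)}(x)=A(T^{n-1}x)\cdots A(Tx)A(x)$, $$L_1^{(n)}(A)=\int_X \tfrac1n\log\|A^{(n)}(x)\|\,\mu(dx),\qquad L_k(A)=\lim_{n\to\infty}\int_X\tfrac1n\log s_k(A^{(n)}(x))\,\mu(dx)\in[-\infty,\infty),$$ where $\|\cdot\|$ is the Euclidean operator norm and $s_1\ge s_2\ge\dots$ are the singular values. *Cocycles.* $\mathcal C=\bigcup_m\mathcal C_m$ is a space of measurable cocycles: $\mathcal C_m$ is a set of measurable functions $A:X\to\mathrm{Mat}_m(\mathbb R)$ with $\|A\|\in L^\infty(\mu)$; $A\in\mathcal C_m$ implies $\wedge_kA\in\mathcal C_{\binom mk}$ for $1\le k\le m$; each $\mathcal C_m$ carries a distance with $\mathrm{dist}(B,A)\ge\|B-A\|_{L^\infty}$, and $A\mapsto\wedge_kA$ is locally Lipschitz. *LDT parameters.* $\mathscr E$ is a set of positive non-increasing functions on $(0,\infty)$. $\mathscr I$ is a convex cone of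 positive, continuous functions $\iota$ on $(0,\infty)$, strictly decreasing to $0$, with $\log t\lesssim\log\frac1{\iota(t)}\lesssim t$ as $t\to\infty$ and $\limsup_{t\to\infty}\varphi_\iota(2t)/\varphi_\iota(t)<2$, where $\varphi_\iota$ is the inverse of $t\mapsto t\,\iota(t)^{-1/2}$; moreover for every $c>0$ some $\iota\in\mathscr I$ satisfies $e^{-ct}\le\iota(t)$ for all large $t$. Write $\iota_n=\iota(n)$. $\mathscr P$ is a set of triplets $(\underline{n_0},\varepsilon,\iota)$ with $\underline{n_0}\ge1$ an integer, $\varepsilon=(\varepsilon_n)\in\mathscr E$, $\iota\in\mathscr I$, containing for every $\epsilon>0$ a triplet with $\varepsilon_{\underline{n_0}}\le\epsilon$. $\Xi$ is a set of integrable measurable functions $X\to\mathbb R$ (observables). *Standing assumptions.* 1. For every $A\in\mathcal C$, $N\in\mathbb N$, $\epsilon>0$ and every $F$ in the algebra generated by the sets $\{\|A^{(n)}\|\le c\}$, $\{\|A^{(n)}\|\ge c\}$ ($c\ge0$, $0\le n\le N$), there is $\xi\in\Xi$ with $\mathbf 1_F\le\xi$ and $\int\xi\,d\mu\le\mu(F)+\epsilon$.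 2. For every $\xi\in\Xi$ and $\epsilon>0$ there is $(\underline{n_0},\varepsilon,\iota)\in\mathscr P$ such that for all $n\ge\underline{n_0}$: $\varepsilon_n\le\epsilon$ and $\mu\{x:|\frac1n\sum_{j=0}^{n-1}\xi(T^jx)-\int\xi\,d\mu|>\varepsilon_n\}<\iota_n$. 3. For every $A\in\mathcal C_m$ with $L_1(A)>-\infty$ there are $\delta>0$, $C<\infty$ with $\|\frac1n\log\|B^{(n)}(\cdot)\|\|_{L^2}<C$ for all $n\ge1$ and all $B\in\mathcal C_m$ with $\mathrm{dist}(B,A)<\delta$. 4. For every $A\in\mathcal C_m$, $m\ge2$, with $L_1(A)>L_2(A)$ and every $\epsilon>0$ there are $\delta>0$ and $(\underline{n_0},\varepsilon,\iota)\in\mathscr P$ such that for all $B\in\mathcal C_m$ with $\mathrm{dist}(B,A)<\delta$ and all $n\ge\underline{n_0}$: $\varepsilon_n\le\epsilon$ and $\mu\{x:|\frac1n\log\|B^{(n)}(x)\|-L_1^{(n)}(B)|>\varepsilon_n\}<\iota_n$. **Proposition 4.3 (inductive step procedure).** Let $m\ge2$ and let $A\in\mathcal C_m$ satisfy $L_1(A)>L_2(A)$.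 Let $\kappa(A)=L_1(A)-L_2(A)$ if $L_2(A)>-\infty$, and let $\kappa(A)$ be any fixed positive real number if $L_2(A)=-\infty$. There is $C=C(A)>0$ such that for every $0<\varepsilon<\kappa(A)/20$ there are $\delta=\delta(A,\varepsilon)>0$, $n_{00}=n_{00}(A,\varepsilon)\in\mathbb N$ and $\iota=\iota(A,\varepsilon)\in\mathscr I$ with the following properties. For all $B\in\mathcal C_m$ with $\mathrm{dist}(B,A)<\delta$ the numbers $L_1^{(n)}(B)$, $n\ge1$, are finite. If $n_0\ge n_{00}$, $B\in\mathcal C_m$, $\mathrm{dist}(B,A)<\delta$, and $\eta_0,\theta_0>0$ are such that (a) $L_1^{(n_0)}(B)-L_1^{(2n_0)}(B)<\eta_0$, (b) $|L_1^{(n_0)}(B)-L_1^{(n_0)}(A)|<\theta_0$, and $4\eta_0+2\theta_0<\kappa(A)-12\varepsilon$, then for every $a>0$ and every integer $n_1$ with $n_0^{1+a}\le n_1\le n_0\,\iota_{n_0}^{-1/2}$: $$\bigl|L_1^{(n_1)}(B)+L_1^{(n_0)}(B)-2L_1^{(2n_0)}(B)\bigr|<C\,\frac{n_0}{n_1},$$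 (a++) $L_1^{(n_1)}(B)-L_1^{(2n_1)}(B)<\eta_1$, where $\eta_1=C\,\frac{n_0}{n_1}$; (b++) if (a) holds for $A$ as well, i.e. $L_1^{(n_0)}(A)-L_1^{(2n_0)}(A)<\eta_0$, then $|L_1^{(n_1)}(B)-L_1^{(n_1)}(A)|<\theta_1$, where $\theta_1=\theta_0+4\eta_0+C\,\frac{n_0}{n_1}$. -/

import Mathlib

open MeasureTheory Filter Topology
open scoped ENNReal NNReal

noncomputable section

namespace LinearCocycle

/-! ### Matrices -/

/-- The operator norm of a real square matrix with respect to the Euclidean norm of `ℝ^m`. -/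
def opNorm {m : ℕ} (g : Matrix (Fin m) (Fin m) ℝ) : ℝ :=
  ‖Matrix.toEuclideanCLM (n := Fin m) (𝕜 := ℝ) g‖

/-- The `k`-th singular value `s_k(g)`, `k = 1, 2, …`, of a real square matrix, in decreasing
order (it is `0` for `k > m`). -/
def singularValue {m : ℕ} (k : ℕ) (g : Matrix (Fin m) (Fin m) ℝ) : ℝ :=
  (Matrix.toEuclideanLin g).singularValues (k - 1)

/-- The lexicographic order on the `k`-element subsets of `{0, …, m - 1}`, each subset being
identified with the increasing list of its elements. -/
abbrev lexOrder (m k : ℕ) : LinearOrder (Set.powersetCard (Fin m) k) :=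
  LinearOrder.lift' (fun s => toLex (fun i : Fin k => Set.powersetCard.ofFinEmbEquiv.symm s i))
    (fun _ _ h => Set.powersetCard.ofFinEmbEquiv.symm.injective
      (DFunLike.coe_injective (toLex.injective h)))

/-- The enumeration of the `k`-element subsets of `{0, …, m - 1}` in lexicographic order. -/
def lexEnum (m k : ℕ) : Fin (m.choose k) ≃ Set.powersetCard (Fin m) k :=
  letI := lexOrder m k
  (monoEquivOfFin (Set.powersetCard (Fin m) k)
    (by rw [← Nat.card_eq_fintype_card, Set.powersetCard.card, Nat.card_eq_fintype_card,
      Fintype.card_fin])).toEquiv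

/-- The `k`-th exterior power `∧_k g` of an `m × m` matrix: the matrix of the linear map induced
by `g` on the `k`-th exterior power of `ℝ^m`, in the basis `e_{i_1} ∧ ⋯ ∧ e_{i_k}`,
`i_1 < ⋯ < i_k`, which is ordered lexicographically. -/
def wedge {m : ℕ} (k : ℕ) (g : Matrix (Fin m) (Fin m) ℝ) :
    Matrix (Fin (m.choose k)) (Fin (m.choose k)) ℝ :=
  (LinearMap.toMatrix ((Pi.basisFun ℝ (Fin m)).exteriorPower k)
    ((Pi.basisFun ℝ (Fin m)).exteriorPower k)
    (exteriorPower.map k (Matrix.toLin' g))).submatrix (lexEnum m k) (lexEnum m k)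

/-! ### Iterates and Lyapunov exponents -/

variable {X : Type*}

/-- The iterates `A^{(n)}(x) = A(T^{n-1} x) ⋯ A(T x) A(x)` of the cocycle `A` over `T`. -/
def iter {m : ℕ} (T : X → X) (A : X → Matrix (Fin m) (Fin m) ℝ) :
    ℕ → X → Matrix (Fin m) (Fin m) ℝ
  | 0, _ => 1
  | n + 1, x => A (T^[n] x) * iter T A n x

/-- `(1/n) log r` for `r ≥ 0`, as an extended real number; it is `-∞` for `r = 0` and `n ≥ 1`. -/
def scaledLog (n : ℕ) (r : ℝ) : EReal :=
  ((1 / (n : ℝ) : ℝ) : EReal) * ENNReal.log (ENNReal.ofReal r)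

variable [MeasurableSpace X]

/-- The integral of an extended real function, i.e. the integral of its positive part minus the
integral of its negative part. It is only used for functions whose positive part has a finite
integral. -/
def expect (μ : Measure X) (f : X → EReal) : EReal :=
  ((∫⁻ x, (f x).toENNReal ∂μ : ℝ≥0∞) : EReal) - ((∫⁻ x, (-f x).toENNReal ∂μ : ℝ≥0∞) : EReal)

/-- The finite scale maximal Lyapunov exponent
`L_1^{(n)}(A) = ∫ (1/n) log ‖A^{(n)}(x)‖ μ(dx) ∈ [-∞, ∞)`. -/
def finiteLE {m : ℕ} (μ : Measure X) (T : X → X) (A : X → Matrix (Fin m) (Fin m) ℝ) (n : ℕ) :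
    EReal :=
  expect μ (fun x => scaledLog n (opNorm (iter T A n x)))

/-- The Lyapunov exponent `L_k(A) = lim_n ∫ (1/n) log s_k(A^{(n)}(x)) μ(dx) ∈ [-∞, ∞)`,
`k = 1, 2, …`. The limit exists for the cocycles considered here, so it is the upper limit. -/
def lyapunov {m : ℕ} (μ : Measure X) (T : X → X) (A : X → Matrix (Fin m) (Fin m) ℝ) (k : ℕ) :
    EReal :=
  limsup (fun n : ℕ => expect μ (fun x => scaledLog n (singularValue k (iter T A n x)))) atTop

/-- `κ` is an admissible value of the gap `κ(A)` between the first two Lyapunov exponents of a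
cocycle with `L_1(A) > L_2(A)`: it is `L_1(A) - L_2(A)` if `L_2(A) > -∞`, and an arbitrary
positive real number, fixed once and for all, if `L_2(A) = -∞`. -/
def IsGap {m : ℕ} (μ : Measure X) (T : X → X) (A : X → Matrix (Fin m) (Fin m) ℝ) (κ : ℝ) : Prop :=
  lyapunov μ T A 2 < lyapunov μ T A 1 ∧ 0 < κ ∧
    (lyapunov μ T A 2 ≠ ⊥ → lyapunov μ T A 1 - lyapunov μ T A 2 = (κ : EReal))

/-! ### Spaces of measurable cocycles -/

/-- A space of measurable cocycles: for every `m` a set of `m × m` matrix valued functions on `X`,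
measurable and essentially bounded, closed under exterior powers, with a distance that is at least
as fine as the `L^∞` distance and for which the exterior powers are locally Lipschitz. (Functions
that agree almost everywhere may be at distance `0`.) -/
structure CocycleSpace (μ : Measure X) where
  carrier : ∀ m : ℕ, Set (X → Matrix (Fin m) (Fin m) ℝ)
  measurable_entries : ∀ m, ∀ A ∈ carrier m, ∀ i j, Measurable (fun x => A x i j)
  bounded : ∀ m, ∀ A ∈ carrier m, MemLp (fun x => opNorm (A x)) ∞ μ
  wedge_mem : ∀ m, ∀ A ∈ carrier m, ∀ k, 1 ≤ k → k ≤ m →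
    (fun x => wedge k (A x)) ∈ carrier (m.choose k)
  metric : ∀ m, PseudoMetricSpace (carrier m)
  linfty_le_dist : ∀ m, ∀ A B : carrier m,
    eLpNorm (fun x => opNorm (B.1 x - A.1 x)) ∞ μ ≤ ENNReal.ofReal ((metric m).dist B A)
  wedge_locallyLipschitz : ∀ (m k : ℕ) (hk : 1 ≤ k) (hkm : k ≤ m),
    @LocallyLipschitz (carrier m) (carrier (m.choose k)) (metric m).toPseudoEMetricSpace
      (metric (m.choose k)).toPseudoEMetricSpace
      (fun A => ⟨fun x => wedge k (A.1 x), wedge_mem m A.1 A.2 k hk hkm⟩)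

namespace CocycleSpace

variable {μ : Measure X}

/-- The space `𝒞_m` of the `m`-dimensional cocycles of `𝒞`. -/
def Dim (C : CocycleSpace μ) (m : ℕ) : Type _ := C.carrier m

instance (C : CocycleSpace μ) (m : ℕ) : PseudoMetricSpace (C.Dim m) := C.metric m

/-- The matrix valued function underlying a cocycle. -/
def Dim.fn {C : CocycleSpace μ} {m : ℕ} (A : C.Dim m) : X → Matrix (Fin m) (Fin m) ℝ := A.1

end CocycleSpace

/-- `L_1^{(n)}(A)` as a real number, for `A ∈ 𝒞_m`; it is only meaningful where the extended number
`finiteLE` is finite. -/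
def realLE {μ : Measure X} (T : X → X) {C : CocycleSpace μ} {m : ℕ} (A : C.Dim m) (n : ℕ) : ℝ :=
  (finiteLE μ T A.fn n).toReal

/-- A cocycle `A ∈ 𝒞_m` is uniformly `L^p`-bounded: there are `δ > 0` and `K < ∞` such that
`‖(1/n) log ‖B^{(n)}(·)‖‖_{L^p} < K` for all `n ≥ 1` and all `B ∈ 𝒞_m` with `dist(B, A) < δ`. -/
def UniformlyLpBounded {μ : Measure X} (T : X → X) {C : CocycleSpace μ} {m : ℕ} (p : ℝ≥0∞)
    (A : C.Dim m) : Prop :=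
  ∃ δ : ℝ, 0 < δ ∧ ∃ K : ℝ≥0, ∀ B : C.Dim m, dist B A < δ → ∀ n : ℕ, 1 ≤ n →
    eLpNorm (fun x => (scaledLog n (opNorm (iter T B.fn n x))).abs) p μ < K

/-- The algebra of sets `𝓕_N(A)` generated by the sets `{‖A^{(n)}‖ ≤ c}` and `{‖A^{(n)}‖ ≥ c}`
with `c ≥ 0` and `0 ≤ n ≤ N`. -/
def normAlgebra {m : ℕ} (T : X → X) (A : X → Matrix (Fin m) (Fin m) ℝ) (N : ℕ) : Set (Set X) :=
  generateSetAlgebra {F | ∃ n ≤ N, ∃ c : ℝ, 0 ≤ c ∧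
    (F = {x | opNorm (iter T A n x) ≤ c} ∨ F = {x | c ≤ opNorm (iter T A n x)})}

/-- The set `Ξ` of observables and the cocycle `A` are compatible. -/
def Compatible {m : ℕ} (μ : Measure X) (T : X → X) (Ξ : Set (X → ℝ))
    (A : X → Matrix (Fin m) (Fin m) ℝ) : Prop :=
  ∀ N : ℕ, ∀ F ∈ normAlgebra T A N, ∀ ε : ℝ, 0 < ε →
    ∃ ξ ∈ Ξ, (∀ x, F.indicator (fun _ => (1 : ℝ)) x ≤ ξ x) ∧ ∫ x, ξ x ∂μ ≤ μ.real F + ε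

/-! ### Large deviation type (LDT) estimates

Functions on `(0, ∞)` are represented by functions on `ℝ`, whose values on `(-∞, 0]` are never
used. -/

/-- Deviation size functions: positive and non-increasing on `(0, ∞)`. -/
def IsDeviationSize (d : ℝ → ℝ) : Prop :=
  (∀ t, 0 < t → 0 < d t) ∧ AntitoneOn d (Set.Ioi 0)

/-- The map `ψ_ι(t) = t ι(t)^{-1/2}`. -/
def psi (f : ℝ → ℝ) (t : ℝ) : ℝ := t * f t ^ (-(1 / 2) : ℝ)

/-- The inverse `φ_ι : (0, ∞) → (0, ∞)` of the bijection `ψ_ι` of `(0, ∞)`. -/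
def phi (f : ℝ → ℝ) : ℝ → ℝ := Function.invFunOn (psi f) (Set.Ioi 0)

/-- Deviation set measure functions `ι`: positive, continuous and strictly decreasing to `0` on
`(0, ∞)`, with `log t ≲ log (1 / ι(t)) ≲ t` as `t → ∞`, and such that
`limsup_{t → ∞} φ_ι(2t) / φ_ι(t) < 2`. -/
structure IsDeviationMeasure (f : ℝ → ℝ) : Prop where
  pos : ∀ t, 0 < t → 0 < f t
  continuousOn : ContinuousOn f (Set.Ioi 0)
  strictAntiOn : StrictAntiOn f (Set.Ioi 0)
  tendsto_zero : Tendsto f atTop (𝓝 0)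
  log_isBigO : (fun t => Real.log t) =O[atTop] (fun t => Real.log (1 / f t))
  isBigO_id : (fun t => Real.log (1 / f t)) =O[atTop] (fun t : ℝ => t)
  limsup_phi : limsup (fun t : ℝ => ((phi f (2 * t) / phi f t : ℝ) : EReal)) atTop < 2

/-- A triplet `(n₀, ε, ι)`. -/
structure LDTParam where
  scale : ℕ
  dev : ℝ → ℝ
  mes : ℝ → ℝ

/-- A set `𝒫` of LDT parameters with the corresponding spaces `ℰ` of deviation size functions and
`ℐ` of deviation set measure functions, the latter being a convex cone. -/
structure LDTSystem where
  sizes : Set (ℝ → ℝ)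
  measures : Set (ℝ → ℝ)
  params : Set LDTParam
  isDeviationSize : ∀ d ∈ sizes, IsDeviationSize d
  isDeviationMeasure : ∀ f ∈ measures, IsDeviationMeasure f
  smul_mem : ∀ a : ℝ, 0 < a → ∀ f ∈ measures, (fun t => a * f t) ∈ measures
  add_mem : ∀ f ∈ measures, ∀ g ∈ measures, (fun t => f t + g t) ∈ measures
  scale_pos : ∀ p ∈ params, 1 ≤ p.scale
  dev_mem : ∀ p ∈ params, p.dev ∈ sizes
  mes_mem : ∀ p ∈ params, p.mes ∈ measures
  exists_small : ∀ ε : ℝ, 0 < ε → ∃ p ∈ params, p.dev p.scale ≤ ε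

/-- The observable `ξ` satisfies a base-LDT estimate. -/
def BaseLDT (μ : Measure X) (T : X → X) (P : LDTSystem) (ξ : X → ℝ) : Prop :=
  ∀ ε : ℝ, 0 < ε → ∃ p ∈ P.params, ∀ n : ℕ, p.scale ≤ n → p.dev n ≤ ε ∧
    μ {x | p.dev n < |(1 / (n : ℝ)) * ∑ j ∈ Finset.range n, ξ (T^[j] x) - ∫ y, ξ y ∂μ|}
      < ENNReal.ofReal (p.mes n)

/-- The cocycle `A` satisfies a uniform fiber-LDT estimate. -/
def UniformFiberLDT {μ : Measure X} (T : X → X) (P : LDTSystem) {C : CocycleSpace μ} {m : ℕ}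
    (A : C.Dim m) : Prop :=
  ∀ ε : ℝ, 0 < ε → ∃ δ : ℝ, 0 < δ ∧ ∃ p ∈ P.params, ∀ B : C.Dim m, dist B A < δ →
    ∀ n : ℕ, p.scale ≤ n → p.dev n ≤ ε ∧
      μ {x | ENNReal.ofReal (p.dev n) <
          (scaledLog n (opNorm (iter T B.fn n x)) - finiteLE μ T B.fn n).abs}
        < ENNReal.ofReal (p.mes n)

end LinearCocycle

end

/-!
Why the statement is true. If the operators in a long product `g_p ⋯ g_0` are nearly of rank one and
consecutive ones do not cancel, then `log ‖g_p ⋯ g_0‖` is, up to a small error,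
`log ‖g_0‖ + ∑ (log ‖g_{i+1} g_i‖ - log ‖g_i‖)`; this is the avalanche principle
(`avalanche_principle`). Applied to the blocks `g_i = B^{(n₀)}(T^{i n₀} x)` and integrated, it gives
`L₁^{(p n₀)} ≈ 2 L₁^{(2 n₀)} - L₁^{(n₀)}` up to `O(1/p)` (`abs_meanLog_block_le`); subadditivity
carries this over to all `n₁ ≥ n₀` (`abs_meanLog_step_le`), and the remaining assertions follow
by comparing `n₁` with `2 n₁`, and `B` with `A`.

The hypotheses of the avalanche principle hold off a small set.
* No cancellation: the fiber-LDT estimates at the scales `n₀` and `2 n₀` replace the norms by the mean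
  exponents, which differ by less than `η₀`.
* Nearly rank one: the relative distance of `g` to a rank-one matrix is at most a constant times
  `‖∧₂ g‖ / ‖g‖²` (`exists_near_rank_one`). The denominator is again controlled by the fiber-LDT
  estimate and `θ₀`. For the numerator, the exponent of `∧₂ A` at some fixed scale is below
  `L₁ + L₂ + ε` (`exists_wedge_majorant`), and this bound spreads to all large scales and to all
  nearby cocycles off LDT-small sets (`exists_upper_deviation`): a step function of `‖∧₂ A^{(N)}‖`
  dominates the `N`-step norms of the nearby cocycles, it is bounded by observables, and those
  satisfy base-LDT estimates.

On the exceptional set, of measure `O(p ι)`, the integrals are small to first order in its measure,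
because the second moment bound is only needed where the functions deviate from their means, a set
of measure `ι` (`LogBound.setIntegral_shift_le`). This is why the range `p ≤ ι^{-1/2}` is admissible
for an error `O(1/p)`.
-/

namespace LinearCocycle

/-! ### Singular values, two-by-two minors and near rank-one approximation -/

section Matrices

variable {m : ℕ}

/-- The continuous linear operator of Euclidean space attached to a matrix. -/
noncomputable abbrev toOp (g : Matrix (Fin m) (Fin m) ℝ) :
    EuclideanSpace ℝ (Fin m) →L[ℝ] EuclideanSpace ℝ (Fin m) :=
  Matrix.toEuclideanCLM (n := Fin m) (𝕜 := ℝ) g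

lemma toOp_mul (g h : Matrix (Fin m) (Fin m) ℝ) : toOp (g * h) = toOp g * toOp h :=
  map_mul (Matrix.toEuclideanCLM (n := Fin m) (𝕜 := ℝ)) g h

lemma opNorm_nonneg (g : Matrix (Fin m) (Fin m) ℝ) : 0 ≤ opNorm g := norm_nonneg _

lemma opNorm_mul_le (g h : Matrix (Fin m) (Fin m) ℝ) : opNorm (g * h) ≤ opNorm g * opNorm h := by
  simp only [opNorm, map_mul]
  exact norm_mul_le _ _

lemma opNorm_add_le (g h : Matrix (Fin m) (Fin m) ℝ) : opNorm (g + h) ≤ opNorm g + opNorm h := by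
  simp only [opNorm, map_add]
  exact norm_add_le _ _

lemma opNorm_le_add_sub (g h : Matrix (Fin m) (Fin m) ℝ) :
    opNorm g ≤ opNorm h + opNorm (g - h) := by
  simpa using opNorm_add_le h (g - h)

lemma opNorm_one_le : opNorm (1 : Matrix (Fin m) (Fin m) ℝ) ≤ 1 := by
  simp only [opNorm, map_one]
  exact ContinuousLinearMap.norm_id_le

lemma continuous_opNorm : Continuous (opNorm : Matrix (Fin m) (Fin m) ℝ → ℝ) :=
  continuous_norm.comp (LinearMap.continuous_of_finiteDimensional
    ((Matrix.toEuclideanCLM (n := Fin m) (𝕜 := ℝ)).toAlgEquiv.toLinearMap))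

lemma toOp_single_apply (g : Matrix (Fin m) (Fin m) ℝ) (i j : Fin m) :
    (toOp g (EuclideanSpace.single j 1)).ofLp i = g i j := by
  simp [toOp, Matrix.ofLp_toEuclideanCLM]

lemma abs_entry_le_opNorm (g : Matrix (Fin m) (Fin m) ℝ) (i j : Fin m) : |g i j| ≤ opNorm g := by
  have h := PiLp.norm_apply_le (toOp g (EuclideanSpace.single j 1)) i
  rw [toOp_single_apply, Real.norm_eq_abs] at h
  have h' := (toOp g).le_opNorm (EuclideanSpace.single j 1)
  rw [PiLp.norm_single, norm_one, mul_one] at h'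
  exact h.trans h'

lemma norm_le_sum_abs (x : EuclideanSpace ℝ (Fin m)) : ‖x‖ ≤ ∑ i, |x i| := by
  rw [EuclideanSpace.norm_eq]
  apply Real.sqrt_le_iff.2 ⟨Finset.sum_nonneg fun i _ => abs_nonneg _, ?_⟩
  exact Finset.sum_sq_le_sq_sum_of_nonneg fun i _ => abs_nonneg _

lemma opNorm_le_of_abs_entry_le {g : Matrix (Fin m) (Fin m) ℝ} {M : ℝ} (hM : 0 ≤ M)
    (h : ∀ i j, |g i j| ≤ M) : opNorm g ≤ (m : ℝ) ^ 2 * M := by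
  refine ContinuousLinearMap.opNorm_le_bound _ (by positivity) fun x => ?_
  refine (norm_le_sum_abs _).trans ?_
  have h1 : ∀ i, |(toOp g x) i| ≤ m * (M * ‖x‖) := by
    intro i
    have : (toOp g x) i = ∑ j, g i j * x j := by
      simp [toOp, Matrix.ofLp_toEuclideanCLM, Matrix.mulVec, dotProduct]
    rw [this]
    refine (Finset.abs_sum_le_sum_abs _ _).trans ?_
    refine (Finset.sum_le_card_nsmul _ _ (M * ‖x‖) fun j _ => ?_).trans (by simp)
    rw [abs_mul]
    exact mul_le_mul (h i j) (PiLp.norm_apply_le x j) (abs_nonneg _) hM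
  refine (Finset.sum_le_card_nsmul _ _ _ fun i _ => h1 i).trans ?_
  simp only [Finset.card_univ, Fintype.card_fin, nsmul_eq_mul]
  apply le_of_eq; ring

/-- An orthonormal basis of right singular vectors: the images of its elements are pairwise
orthogonal, and their lengths are the singular values in decreasing order. -/
lemma exists_singular_basis (g : Matrix (Fin m) (Fin m) ℝ) :
    ∃ b : OrthonormalBasis (Fin m) ℝ (EuclideanSpace ℝ (Fin m)), ∀ i x,
      inner ℝ (toOp g (b i)) (toOp g x) =
        (Matrix.toEuclideanLin g).singularValues i ^ 2 * inner ℝ (b i) x := by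
  set G : EuclideanSpace ℝ (Fin m) →ₗ[ℝ] EuclideanSpace ℝ (Fin m) := Matrix.toEuclideanLin g
  have hn : Module.finrank ℝ (EuclideanSpace ℝ (Fin m)) = m := by simp
  refine ⟨G.isSymmetric_adjoint_comp_self.eigenvectorBasis hn, fun i x => ?_⟩
  have h1 := G.isSymmetric_adjoint_comp_self.apply_eigenvectorBasis hn i
  rw [LinearMap.sq_singularValues_fin G hn]
  set b := G.isSymmetric_adjoint_comp_self.eigenvectorBasis hn
  have h2 : inner ℝ (G (b i)) (G x) = inner ℝ (LinearMap.adjoint G (G (b i))) x :=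
    (LinearMap.adjoint_inner_left G x (G (b i))).symm
  have h3 : LinearMap.adjoint G (G (b i)) = (G.isSymmetric_adjoint_comp_self.eigenvalues hn i) • b i :=
    h1
  rw [h3, real_inner_smul_left] at h2
  exact h2

/-- On the orthogonal complement of the first `k` singular vectors the operator norm is at most the
singular value with (zero-based) index `k`. -/
lemma norm_toOp_le_of_orthogonal (g : Matrix (Fin m) (Fin m) ℝ)
    (b : OrthonormalBasis (Fin m) ℝ (EuclideanSpace ℝ (Fin m)))
    (hb : ∀ i x, inner ℝ (toOp g (b i)) (toOp g x) =
        (Matrix.toEuclideanLin g).singularValues i ^ 2 * inner ℝ (b i) x)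
    (k : ℕ) (x : EuclideanSpace ℝ (Fin m)) (hx : ∀ i : Fin m, (i : ℕ) < k → inner ℝ (b i) x = 0) :
    ‖toOp g x‖ ≤ (Matrix.toEuclideanLin g).singularValues k * ‖x‖ := by
  have hs := fun i => (Matrix.toEuclideanLin g).singularValues_nonneg i
  have hanti := (Matrix.toEuclideanLin g).singularValues_antitone
  refine le_of_sq_le_sq ?_ (mul_nonneg (hs k) (norm_nonneg _))
  have h1 : ‖toOp g x‖ ^ 2 =
      ∑ i : Fin m, (Matrix.toEuclideanLin g).singularValues i ^ 2 * inner ℝ (b i) x ^ 2 := by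
    rw [← real_inner_self_eq_norm_sq]
    have h2 : x = ∑ i, inner ℝ (b i) x • b i := (b.sum_repr' x).symm
    conv_lhs => enter [2]; rw [h2]
    rw [map_sum, sum_inner]
    refine Finset.sum_congr rfl fun i _ => ?_
    rw [map_smul, real_inner_smul_left, hb]
    ring
  rw [h1, mul_pow, ← b.sum_sq_norm_inner_right x, Finset.mul_sum]
  refine Finset.sum_le_sum fun i _ => ?_
  rw [Real.norm_eq_abs, sq_abs]
  rcases lt_or_ge (i : ℕ) k with h | h
  · simp [hx i h]
  · have := pow_le_pow_left₀ (hs i) (hanti h) 2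
    exact mul_le_mul_of_nonneg_right this (sq_nonneg _)

lemma opNorm_eq_singularValue_one (hm : 0 < m) (g : Matrix (Fin m) (Fin m) ℝ) :
    opNorm g = singularValue 1 g := by
  obtain ⟨b, hb⟩ := exists_singular_basis g
  have hs := (Matrix.toEuclideanLin g).singularValues_nonneg 0
  apply le_antisymm
  · exact ContinuousLinearMap.opNorm_le_bound _ hs fun x =>
      norm_toOp_le_of_orthogonal g b hb 0 x fun i hi => absurd hi (Nat.not_lt_zero _)
  · have h1 := hb ⟨0, hm⟩ (b ⟨0, hm⟩)
    rw [real_inner_self_eq_norm_sq, real_inner_self_eq_norm_sq, b.norm_eq_one] at h1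
    have h2 : ‖toOp g (b ⟨0, hm⟩)‖ = (Matrix.toEuclideanLin g).singularValues 0 :=
      (sq_eq_sq₀ (norm_nonneg _) hs).1 (by simpa using h1)
    have h3 := (toOp g).le_opNorm (b ⟨0, hm⟩)
    rw [h2, b.norm_eq_one, mul_one] at h3
    exact h3

/-- The `(i, j)` Plücker coordinate of `p ∧ q`. -/
def minor (p q : EuclideanSpace ℝ (Fin m)) (i j : Fin m) : ℝ := p i * q j - p j * q i

lemma abs_minor_le (p q : EuclideanSpace ℝ (Fin m)) (i j : Fin m) :
    |minor p q i j| ≤ 2 * (‖p‖ * ‖q‖) := by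
  have hp := fun i => PiLp.norm_apply_le p i
  have hq := fun i => PiLp.norm_apply_le q i
  have h : ∀ i j, |p i * q j| ≤ ‖p‖ * ‖q‖ := fun i j => by
    rw [abs_mul]; exact mul_le_mul (hp i) (hq j) (abs_nonneg _) (norm_nonneg _)
  unfold minor
  linarith [abs_sub (p i * q j) (p j * q i), h i j, h j i]

/-- Lagrange's identity for orthogonal vectors. -/
lemma sum_sq_minor {p q : EuclideanSpace ℝ (Fin m)} (h : inner ℝ p q = 0) :
    ∑ i, ∑ j, minor p q i j ^ 2 = 2 * (‖p‖ ^ 2 * ‖q‖ ^ 2) := by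
  have h0 : ∑ i, p i * q i = 0 := by
    rw [← h, PiLp.inner_apply]; simp [mul_comm]
  have h1 : ∀ i j, minor p q i j ^ 2 =
      p i ^ 2 * q j ^ 2 + q i ^ 2 * p j ^ 2 - 2 * ((p i * q i) * (p j * q j)) := by
    intro i j; unfold minor; ring
  simp only [h1, Finset.sum_add_distrib, Finset.sum_sub_distrib, ← Finset.mul_sum,
    ← Finset.sum_mul, h0]
  rw [EuclideanSpace.real_norm_sq_eq, EuclideanSpace.real_norm_sq_eq]
  ring

/-- The entries of the second exterior power of `g` are the minors of `g` of order two. -/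
lemma wedge_two_apply (g : Matrix (Fin m) (Fin m) ℝ) (s t : Fin (m.choose 2)) :
    wedge 2 g s t =
      minor (toOp g (EuclideanSpace.single (Set.powersetCard.ofFinEmbEquiv.symm (lexEnum m 2 t) 0) 1))
        (toOp g (EuclideanSpace.single (Set.powersetCard.ofFinEmbEquiv.symm (lexEnum m 2 t) 1) 1))
        (Set.powersetCard.ofFinEmbEquiv.symm (lexEnum m 2 s) 0)
        (Set.powersetCard.ofFinEmbEquiv.symm (lexEnum m 2 s) 1) := by
  rw [wedge, Matrix.submatrix_apply, LinearMap.toMatrix_apply, exteriorPower.basis_repr_apply,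
    exteriorPower.basis_apply, exteriorPower.map_apply_ιMulti_family, exteriorPower.ιMulti_family,
    exteriorPower.ιMultiDual_apply_ιMulti, Matrix.det_fin_two]
  simp [minor, toOp_single_apply]

lemma wedge_mul (k : ℕ) (g h : Matrix (Fin m) (Fin m) ℝ) :
    wedge k (g * h) = wedge k g * wedge k h := by
  simp only [wedge]
  rw [Matrix.toLin'_mul, exteriorPower.map_comp,
    LinearMap.toMatrix_comp _ ((Pi.basisFun ℝ (Fin m)).exteriorPower k)]
  exact (Matrix.submatrix_mul_equiv _ _ _ (lexEnum m k) _).symm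

lemma wedge_one (k : ℕ) : wedge k (1 : Matrix (Fin m) (Fin m) ℝ) = 1 := by
  rw [wedge, Matrix.toLin'_one, exteriorPower.map_id, LinearMap.toMatrix_id,
    Matrix.submatrix_one_equiv]

lemma exists_lexEnum {i j : Fin m} (h : i < j) : ∃ s : Fin (m.choose 2),
    Set.powersetCard.ofFinEmbEquiv.symm (lexEnum m 2 s) 0 = i ∧
    Set.powersetCard.ofFinEmbEquiv.symm (lexEnum m 2 s) 1 = j := by
  have hmono : StrictMono ![i, j] := by
    intro a b hab
    fin_cases a <;> fin_cases b <;> simp_all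
  refine ⟨(lexEnum m 2).symm (Set.powersetCard.ofFinEmbEquiv (OrderEmbedding.ofStrictMono _ hmono)),
    ?_, ?_⟩ <;> simp

lemma abs_minor_single_le (g : Matrix (Fin m) (Fin m) ℝ) (i j a b : Fin m) :
    |minor (toOp g (EuclideanSpace.single a 1)) (toOp g (EuclideanSpace.single b 1)) i j|
      ≤ opNorm (wedge 2 g) := by
  have key : ∀ i j a b : Fin m, i < j → a < b →
      |minor (toOp g (EuclideanSpace.single a 1)) (toOp g (EuclideanSpace.single b 1)) i j|
      ≤ opNorm (wedge 2 g) := by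
    intro i j a b hij hab
    obtain ⟨s, hs0, hs1⟩ := exists_lexEnum hij
    obtain ⟨t, ht0, ht1⟩ := exists_lexEnum hab
    have := abs_entry_le_opNorm (wedge 2 g) s t
    rwa [wedge_two_apply, hs0, hs1, ht0, ht1] at this
  have swap1 : ∀ (p q : EuclideanSpace ℝ (Fin m)) i j, |minor p q i j| = |minor q p i j| := by
    intro p q i j; rw [← abs_neg]; congr 1; unfold minor; ring
  have swap2 : ∀ (p q : EuclideanSpace ℝ (Fin m)) i j, |minor p q i j| = |minor p q j i| := by
    intro p q i j; rw [← abs_neg]; congr 1; unfold minor; ring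
  have key2 : ∀ i j a b : Fin m, i < j →
      |minor (toOp g (EuclideanSpace.single a 1)) (toOp g (EuclideanSpace.single b 1)) i j|
      ≤ opNorm (wedge 2 g) := by
    intro i j a b hij
    rcases lt_trichotomy a b with h | rfl | h
    · exact key i j a b hij h
    · simpa [minor, mul_comm] using opNorm_nonneg (wedge 2 g)
    · rw [swap1]; exact key i j b a hij h
  rcases lt_trichotomy i j with h | rfl | h
  · exact key2 i j a b h
  · simpa [minor] using opNorm_nonneg (wedge 2 g)
  · rw [swap2]; exact key2 j i a b h

lemma abs_minor_toOp_le (g : Matrix (Fin m) (Fin m) ℝ) (x y : EuclideanSpace ℝ (Fin m))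
    (i j : Fin m) :
    |minor (toOp g x) (toOp g y) i j| ≤ (m : ℝ) ^ 2 * (opNorm (wedge 2 g) * (‖x‖ * ‖y‖)) := by
  have hD := opNorm_nonneg (wedge 2 g)
  have hrep : ∀ (x : EuclideanSpace ℝ (Fin m)) i,
      (toOp g x) i = ∑ a, (toOp g (EuclideanSpace.single a 1)) i * x a := by
    intro x i
    simp only [toOp_single_apply]
    simp [toOp, Matrix.ofLp_toEuclideanCLM, Matrix.mulVec, dotProduct]
  have h1 : minor (toOp g x) (toOp g y) i j = ∑ a, ∑ b, (x a * y b) *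
      minor (toOp g (EuclideanSpace.single a 1)) (toOp g (EuclideanSpace.single b 1)) i j := by
    simp only [minor, hrep x, hrep y, Finset.sum_mul_sum, ← Finset.sum_sub_distrib]
    refine Finset.sum_congr rfl fun a _ => Finset.sum_congr rfl fun b _ => ?_
    ring
  rw [h1]
  have h2 : ∀ a b, |(x a * y b) *
      minor (toOp g (EuclideanSpace.single a 1)) (toOp g (EuclideanSpace.single b 1)) i j| ≤
      opNorm (wedge 2 g) * (‖x‖ * ‖y‖) := by
    intro a b
    rw [abs_mul, abs_mul, mul_comm]
    exact mul_le_mul (abs_minor_single_le g i j a b)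
      (mul_le_mul (PiLp.norm_apply_le x a) (PiLp.norm_apply_le y b) (abs_nonneg _) (norm_nonneg _))
      (by positivity) hD
  refine (Finset.abs_sum_le_sum_abs _ _).trans ?_
  refine (Finset.sum_le_card_nsmul _ _ (m * (opNorm (wedge 2 g) * (‖x‖ * ‖y‖))) fun a _ =>
    (Finset.abs_sum_le_sum_abs _ _).trans ?_).trans ?_
  · exact (Finset.sum_le_card_nsmul _ _ _ fun b _ => h2 a b).trans (by simp)
  · simp only [Finset.card_univ, Fintype.card_fin, nsmul_eq_mul]
    apply le_of_eq; ring

/-- Up to a constant, `‖∧₂ g‖` is at most the product of the first two singular values. -/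
lemma opNorm_wedge_two_le (hm : 2 ≤ m) (g : Matrix (Fin m) (Fin m) ℝ) :
    opNorm (wedge 2 g) ≤
      ((m.choose 2 : ℕ) : ℝ) ^ 2 * (6 * (opNorm g * singularValue 2 g)) := by
  obtain ⟨b, hb⟩ := exists_singular_basis g
  have hs1 : 0 ≤ singularValue 2 g := (Matrix.toEuclideanLin g).singularValues_nonneg 1
  have hs01 : singularValue 2 g ≤ opNorm g := by
    rw [opNorm_eq_singularValue_one (by omega)]
    exact (Matrix.toEuclideanLin g).singularValues_antitone zero_le_one
  have hg := opNorm_nonneg g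
  refine opNorm_le_of_abs_entry_le (by positivity) fun s t => ?_
  rw [wedge_two_apply]
  generalize (Set.powersetCard.ofFinEmbEquiv.symm (lexEnum m 2 t) 0) = c
  generalize (Set.powersetCard.ofFinEmbEquiv.symm (lexEnum m 2 t) 1) = d
  generalize (Set.powersetCard.ofFinEmbEquiv.symm (lexEnum m 2 s) 0) = i
  generalize (Set.powersetCard.ofFinEmbEquiv.symm (lexEnum m 2 s) 1) = j
  set v := b ⟨0, by omega⟩ with hv
  have hv1 : ‖v‖ = 1 := b.norm_eq_one _
  -- split off the component along the first singular vector
  have dec : ∀ a : Fin m, ∃ (α : ℝ) (q : EuclideanSpace ℝ (Fin m)), |α| ≤ 1 ∧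
      ‖q‖ ≤ singularValue 2 g ∧ toOp g (EuclideanSpace.single a 1) = α • toOp g v + q := by
    intro a
    set e : EuclideanSpace ℝ (Fin m) := EuclideanSpace.single a 1 with he
    have he1 : ‖e‖ = 1 := by simp [he]
    set α := inner ℝ v e with hα
    have hα1 : |α| ≤ 1 := by
      have := abs_real_inner_le_norm v e
      rwa [hv1, he1, one_mul] at this
    have horth : inner ℝ v (e - α • v) = 0 := by
      rw [inner_sub_right, real_inner_smul_right, real_inner_self_eq_norm_sq, hv1]; simp [hα]
    have hx1 : ‖e - α • v‖ ≤ 1 := by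
      have h3 : ‖e‖ ^ 2 = ‖α • v‖ ^ 2 + ‖e - α • v‖ ^ 2 := by
        have h4 : inner ℝ (α • v) (e - α • v) = 0 := by
          rw [real_inner_smul_left, horth, mul_zero]
        have h5 := norm_add_sq_eq_norm_sq_add_norm_sq_of_inner_eq_zero (α • v) (e - α • v) h4
        simp only [add_sub_cancel] at h5
        nlinarith
      rw [he1] at h3
      nlinarith [sq_nonneg ‖α • v‖, norm_nonneg (e - α • v)]
    refine ⟨α, toOp g (e - α • v), hα1, ?_, by simp⟩
    have h6 := norm_toOp_le_of_orthogonal g b hb 1 (e - α • v) fun i hi => by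
      have : i = ⟨0, by omega⟩ := Fin.ext (by simpa using hi)
      rw [this]; exact horth
    refine h6.trans ?_
    exact mul_le_of_le_one_right hs1 hx1
  obtain ⟨α, q, hα, hq, hc⟩ := dec c
  obtain ⟨β, r, hβ, hr, hd⟩ := dec d
  have hp : ‖toOp g v‖ ≤ opNorm g := by
    have := (toOp g).le_opNorm v
    rwa [hv1, mul_one] at this
  have hexp : minor (toOp g (EuclideanSpace.single c 1)) (toOp g (EuclideanSpace.single d 1)) i j =
      α * minor (toOp g v) r i j + β * minor q (toOp g v) i j + minor q r i j := by
    rw [hc, hd]; simp only [minor, PiLp.add_apply, PiLp.smul_apply, smul_eq_mul]; ring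
  rw [hexp]
  have e1 : |α * minor (toOp g v) r i j| ≤ 2 * (opNorm g * singularValue 2 g) := by
    rw [abs_mul]
    refine (mul_le_of_le_one_left (abs_nonneg _) hα).trans ((abs_minor_le _ _ i j).trans ?_)
    gcongr
  have e2 : |β * minor q (toOp g v) i j| ≤ 2 * (opNorm g * singularValue 2 g) := by
    rw [abs_mul]
    refine (mul_le_of_le_one_left (abs_nonneg _) hβ).trans ((abs_minor_le _ _ i j).trans ?_)
    rw [mul_comm ‖q‖]
    gcongr
  have e3 : |minor q r i j| ≤ 2 * (opNorm g * singularValue 2 g) := by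
    refine (abs_minor_le _ _ i j).trans ?_
    have := hq.trans hs01
    gcongr
  have := abs_add_le (α * minor (toOp g v) r i j + β * minor q (toOp g v) i j) (minor q r i j)
  have := abs_add_le (α * minor (toOp g v) r i j) (β * minor q (toOp g v) i j)
  linarith

/-- A matrix is a rank-one matrix up to an error controlled by `‖∧₂ g‖ / ‖g‖`: the error vanishes
on the first right singular vector and maps its orthogonal complement to the orthogonal complement
of the first left singular vector, where Lagrange's identity bounds it by areas. -/
lemma exists_near_rank_one (hm : 2 ≤ m) (g : Matrix (Fin m) (Fin m) ℝ) (hg : 0 < opNorm g) :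
    ∃ (φ : EuclideanSpace ℝ (Fin m) →L[ℝ] ℝ) (u : EuclideanSpace ℝ (Fin m)), ‖φ‖ = 1 ∧ ‖u‖ = 1 ∧
      ‖toOp g - opNorm g • φ.smulRight u‖ * opNorm g ≤ (m : ℝ) ^ 3 * opNorm (wedge 2 g) := by
  obtain ⟨b, hb⟩ := exists_singular_basis g
  set v := b ⟨0, by omega⟩ with hv
  have hv1 : ‖v‖ = 1 := b.norm_eq_one _
  have hD := opNorm_nonneg (wedge 2 g)
  have hbv : ∀ x, inner ℝ (toOp g v) (toOp g x) = opNorm g ^ 2 * inner ℝ v x := by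
    intro x
    rw [opNorm_eq_singularValue_one (by omega)]
    exact hb ⟨0, by omega⟩ x
  have hgv : ‖toOp g v‖ = opNorm g := by
    have h1 := hbv v
    rw [real_inner_self_eq_norm_sq, real_inner_self_eq_norm_sq, hv1] at h1
    exact (sq_eq_sq₀ (norm_nonneg _) hg.le).1 (by simpa using h1)
  refine ⟨innerSL ℝ v, (opNorm g)⁻¹ • toOp g v, by rw [innerSL_apply_norm, hv1], ?_, ?_⟩
  · rw [norm_smul, hgv, norm_inv, Real.norm_eq_abs, abs_of_pos hg, inv_mul_cancel₀ hg.ne']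
  · rw [← le_div_iff₀ hg]
    refine ContinuousLinearMap.opNorm_le_bound _ (by positivity) fun x => ?_
    set y := x - inner ℝ v x • v with hy
    have horth : inner ℝ v y = 0 := by
      rw [hy, inner_sub_right, real_inner_smul_right, real_inner_self_eq_norm_sq, hv1]; simp
    have hyx : ‖y‖ ≤ ‖x‖ := by
      have h4 : inner ℝ (inner ℝ v x • v) y = 0 := by
        rw [real_inner_smul_left, horth, mul_zero]
      have h5 := norm_add_sq_eq_norm_sq_add_norm_sq_of_inner_eq_zero _ _ h4
      simp only [hy, add_sub_cancel] at h5
      rw [← hy] at h5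
      exact le_of_sq_le_sq (by nlinarith [mul_self_nonneg ‖inner ℝ v x • v‖]) (norm_nonneg _)
    have hrx : (toOp g - opNorm g • (innerSL ℝ v).smulRight ((opNorm g)⁻¹ • toOp g v)) x
        = toOp g y := by
      simp only [hy, sub_apply, smul_apply,
        ContinuousLinearMap.smulRight_apply, map_sub, map_smul, innerSL_apply_apply]
      rw [smul_comm (opNorm g), smul_smul (opNorm g), mul_inv_cancel₀ hg.ne', one_smul]
    rw [hrx, div_mul_eq_mul_div, le_div_iff₀ hg]
    have h6 : inner ℝ (toOp g v) (toOp g y) = 0 := by rw [hbv, horth, mul_zero]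
    have h7 := sum_sq_minor h6
    have h8 : ∑ i, ∑ j, minor (toOp g v) (toOp g y) i j ^ 2 ≤
        (m : ℝ) ^ 2 * ((m : ℝ) ^ 2 * (opNorm (wedge 2 g) * (1 * ‖y‖))) ^ 2 := by
      have h9 : ∀ i j, minor (toOp g v) (toOp g y) i j ^ 2 ≤
          ((m : ℝ) ^ 2 * (opNorm (wedge 2 g) * (1 * ‖y‖))) ^ 2 := by
        intro i j
        have := abs_minor_toOp_le g v y i j
        rw [hv1] at this
        exact sq_le_sq' (by linarith [neg_abs_le (minor (toOp g v) (toOp g y) i j)])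
          ((le_abs_self _).trans this)
      refine (Finset.sum_le_sum fun i _ => Finset.sum_le_card_nsmul _ _ _ fun j _ => h9 i j).trans ?_
      simp only [Finset.sum_const, Finset.card_univ, Fintype.card_fin, nsmul_eq_mul]
      apply le_of_eq; ring
    rw [h7, hgv] at h8
    refine le_of_sq_le_sq ?_ (by positivity)
    have h10 : ((m : ℝ) ^ 3 * opNorm (wedge 2 g) * ‖y‖) ^ 2 ≤
        ((m : ℝ) ^ 3 * opNorm (wedge 2 g) * ‖x‖) ^ 2 := by gcongr
    nlinarith [sq_nonneg (opNorm g * ‖toOp g y‖)]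

end Matrices

/-! ### The avalanche principle -/

section Avalanche

lemma abs_log_sub_log_le {x y t : ℝ} (hy : 0 < y) (ht : t ≤ 1 / 2) (h : |x - y| ≤ t * y) :
    |Real.log x - Real.log y| ≤ 2 * t := by
  have ht0 : 0 ≤ t := by
    by_contra hc
    have := (abs_nonneg (x - y)).trans h
    nlinarith
  obtain ⟨h1, h2⟩ := abs_le.1 h
  have hx : 0 < x := by nlinarith
  rw [← Real.log_div hx.ne' hy.ne', abs_le]
  have hr1 : x / y ≤ 1 + t := by rw [div_le_iff₀ hy]; linarith
  have hr2 : 1 - t ≤ x / y := by rw [le_div_iff₀ hy]; linarith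
  have hr : 0 < x / y := div_pos hx hy
  constructor
  · have h3 := Real.one_sub_inv_le_log_of_pos hr
    have h4 : (x / y)⁻¹ ≤ 1 + 2 * t := by
      rw [inv_le_comm₀ hr (by linarith)]
      refine le_trans ?_ hr2
      rw [inv_le_iff_one_le_mul₀ (by linarith)]
      nlinarith
    linarith
  · have := Real.log_le_sub_one_of_pos hr
    linarith

/-- The numerical part of a step of the avalanche principle: `W`, `N`, `G` are the norms of `w`, `g`,
`g'`, and `a` stands for `‖g' u‖`. -/
lemma avalanche_log {W N G a κ ε gh hn gg : ℝ} (hW : 0 < W) (hN : 0 < N) (hG : 0 < G) (hε : 0 < ε)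
    (hε1 : ε ≤ 1) (hκ0 : 0 ≤ κ) (hκ : κ ≤ ε ^ 2 / 100) (ha : (ε - κ) * G ≤ a)
    (c1 : |gh - W * a| ≤ G * (2 * κ / ε * W)) (c2 : |hn - W| ≤ 2 * κ / ε * W)
    (c3 : |gg - N * a| ≤ G * (κ * N)) :
    |Real.log gh - Real.log hn - (Real.log gg - Real.log N)| ≤ 16 * (κ / ε ^ 2) := by
  obtain ⟨q, hq⟩ : ∃ q, q = κ / ε ^ 2 := ⟨_, rfl⟩
  have hqε : κ = q * ε ^ 2 := by rw [hq]; field_simp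
  have hq0 : 0 ≤ q := by rw [hq]; positivity
  have hq1 : q ≤ 1 / 100 := by rw [hq, div_le_iff₀ (by positivity)]; linarith
  have hε2 : ε ^ 2 ≤ ε := by nlinarith
  have hκε : κ ≤ q * ε := by rw [hqε]; exact mul_le_mul_of_nonneg_left hε2 hq0
  have hρ : 2 * κ / ε = 2 * q * ε := by rw [hqε]; field_simp
  have haG : ε * G ≤ 2 * a := by
    have : κ ≤ ε / 2 := by nlinarith
    nlinarith
  have ha0 : 0 < a := by have := mul_pos hε hG; linarith
  rw [hρ] at c1 c2
  rw [← hq]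
  have l1 : |Real.log gh - Real.log (W * a)| ≤ 2 * (4 * q) := by
    refine abs_log_sub_log_le (mul_pos hW ha0) (by linarith) (c1.trans ?_)
    calc G * (2 * q * ε * W) = (2 * q * W) * (ε * G) := by ring
      _ ≤ (2 * q * W) * (2 * a) := by gcongr
      _ = _ := by ring
  have l2 : |Real.log hn - Real.log W| ≤ 2 * (2 * q) := by
    refine abs_log_sub_log_le hW (by linarith) (c2.trans ?_)
    exact mul_le_mul_of_nonneg_right (mul_le_of_le_one_right (by positivity) hε1) hW.le
  have l3 : |Real.log gg - Real.log (N * a)| ≤ 2 * (2 * q) := by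
    refine abs_log_sub_log_le (mul_pos hN ha0) (by linarith) (c3.trans ?_)
    calc G * (κ * N) ≤ G * (q * ε * N) := by gcongr
      _ = (q * N) * (ε * G) := by ring
      _ ≤ (q * N) * (2 * a) := by gcongr
      _ = _ := by ring
  rw [Real.log_mul hW.ne' ha0.ne'] at l1
  rw [Real.log_mul hN.ne' ha0.ne'] at l3
  rw [abs_le] at l1 l2 l3 ⊢
  constructor <;> linarith

variable {E : Type*} [NormedAddCommGroup E] [NormedSpace ℝ E]

/-- One step of the avalanche principle. If `h = w ⊗ u + O(ρ)` is nearly of rank one with the same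
range direction `u` as `g`, then `g' h` is nearly of rank one with the range direction `u'` of `g'`,
with no loss in the relative error, and `‖g' h‖ / ‖h‖` is close to `‖g' g‖ / ‖g‖`, since both are
close to `‖g' u‖`. -/
lemma avalanche_step {g g' h : E →L[ℝ] E} {φ φ' w : E →L[ℝ] ℝ} {u u' : E} {κ ε : ℝ}
    (hg : 0 < ‖g‖) (hg' : 0 < ‖g'‖) (hw : 0 < ‖w‖) (hφ : ‖φ‖ = 1) (hφ' : ‖φ'‖ = 1)
    (hu : ‖u‖ = 1) (hu' : ‖u'‖ = 1) (hε : 0 < ε) (hκ0 : 0 ≤ κ) (hκ : κ ≤ ε ^ 2 / 100)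
    (hr : ‖g - ‖g‖ • φ.smulRight u‖ ≤ κ * ‖g‖) (hr' : ‖g' - ‖g'‖ • φ'.smulRight u'‖ ≤ κ * ‖g'‖)
    (hang : ε * (‖g'‖ * ‖g‖) ≤ ‖g' * g‖) (hh : ‖h - w.smulRight u‖ ≤ 2 * κ / ε * ‖w‖) :
    (∃ w' : E →L[ℝ] ℝ, 0 < ‖w'‖ ∧ ‖g' * h - w'.smulRight u'‖ ≤ 2 * κ / ε * ‖w'‖) ∧
      |Real.log ‖g' * h‖ - Real.log ‖h‖ - (Real.log ‖g' * g‖ - Real.log ‖g‖)|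
        ≤ 16 * (κ / ε ^ 2) := by
  set G := ‖g'‖ with hG
  set ρ := 2 * κ / ε with hρ
  have hε1 : ε ≤ 1 := by
    have h1 := hang.trans (norm_mul_le g' g)
    have h2 : 0 < G * ‖g‖ := mul_pos hg' hg
    nlinarith
  have hρε : ρ * ε = 2 * κ := by rw [hρ]; field_simp
  have hρ0 : 0 ≤ ρ := by positivity
  have hρs : ρ ≤ ε / 50 := by
    rw [hρ, div_le_iff₀ hε]; nlinarith
  have hκε : κ ≤ ε / 100 := by nlinarith
  set a := ‖g' u‖ with ha
  have hcomp : ∀ (ψ : E →L[ℝ] ℝ) (v : E) (k f : E →L[ℝ] E), ‖v‖ = 1 →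
      |‖k * f‖ - ‖ψ‖ * ‖k v‖| ≤ ‖k‖ * ‖f - ψ.smulRight v‖ := by
    intro ψ v k f hv
    have h1 : k * f - ψ.smulRight (k v) = k * (f - ψ.smulRight v) := by
      ext x; simp
    have h2 := abs_norm_sub_norm_le (k * f) (ψ.smulRight (k v))
    rw [h1, ContinuousLinearMap.norm_smulRight_apply] at h2
    exact h2.trans (norm_mul_le _ _)
  -- the three comparisons with `‖g' u‖`
  have c1 : |‖g' * h‖ - ‖w‖ * a| ≤ G * (ρ * ‖w‖) :=
    (hcomp w u g' h hu).trans (mul_le_mul_of_nonneg_left hh hg'.le)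
  have c2 : |‖h‖ - ‖w‖| ≤ ρ * ‖w‖ := by
    have h2 := abs_norm_sub_norm_le h (w.smulRight u)
    rw [ContinuousLinearMap.norm_smulRight_apply, hu, mul_one] at h2
    exact h2.trans hh
  have c3 : |‖g' * g‖ - ‖g‖ * a| ≤ G * (κ * ‖g‖) := by
    have h1 := hcomp (‖g‖ • φ) u g' g hu
    have h2 : (‖g‖ • φ).smulRight u = ‖g‖ • φ.smulRight u := by ext x; simp [mul_smul]
    rw [norm_smul, hφ, norm_norm, mul_one, h2] at h1
    exact h1.trans (mul_le_mul_of_nonneg_left hr hg'.le)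
  have ha1 : (ε - κ) * G ≤ a := by
    have h1 := (abs_le.1 c3).2
    have h2 : ‖g‖ * ((ε - κ) * G) ≤ ‖g‖ * a := by nlinarith
    exact le_of_mul_le_mul_left h2 hg
  have ha0 : 0 < a := lt_of_lt_of_le (mul_pos (by linarith) hg') ha1
  constructor
  · have hφu : ε - 2 * κ ≤ |φ' u| := by
      have h1 : g' u = (‖g'‖ * φ' u) • u' + (g' - ‖g'‖ • φ'.smulRight u') u := by
        simp [mul_smul]
      have h2 : a ≤ G * |φ' u| + κ * G := by
        rw [ha, h1]
        refine (norm_add_le _ _).trans (add_le_add ?_ ?_)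
        · rw [norm_smul, hu', mul_one, norm_mul, Real.norm_eq_abs, Real.norm_eq_abs, abs_of_pos hg']
        · refine (ContinuousLinearMap.le_opNorm _ _).trans ?_
          rw [hu, mul_one]; exact hr'
      have h3 : G * (ε - 2 * κ) ≤ G * |φ' u| := by nlinarith
      exact le_of_mul_le_mul_left h3 hg'
    set w' : E →L[ℝ] ℝ := G • φ'.comp h with hw'
    have hlow : G * ((ε - 2 * κ - ρ) * ‖w‖) ≤ ‖w'‖ := by
      have h1 : φ'.comp h = (φ' u) • w + φ'.comp (h - w.smulRight u) := by
        ext x; simp [mul_comm]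
      have h2 : |φ' u| * ‖w‖ - ρ * ‖w‖ ≤ ‖φ'.comp h‖ := by
        have h3 : (φ' u) • w = φ'.comp h - φ'.comp (h - w.smulRight u) := by
          rw [h1]; abel
        have h4 := norm_sub_le (φ'.comp h) (φ'.comp (h - w.smulRight u))
        rw [← h3, norm_smul, Real.norm_eq_abs] at h4
        have h5 := φ'.opNorm_comp_le (h - w.smulRight u)
        rw [hφ', one_mul] at h5
        linarith
      rw [hw', norm_smul, Real.norm_eq_abs, abs_of_pos hg']
      refine mul_le_mul_of_nonneg_left ?_ hg'.le
      nlinarith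
    have hpos : 0 < G * ((ε - 2 * κ - ρ) * ‖w‖) :=
      mul_pos hg' (mul_pos (by linarith) hw)
    refine ⟨w', hpos.trans_le hlow, ?_⟩
    have h1 : g' * h - w'.smulRight u' = (g' - ‖g'‖ • φ'.smulRight u') * h := by
      ext x; simp [hw', hG, mul_smul]
    rw [h1]
    have hhn : ‖h‖ ≤ (1 + ρ) * ‖w‖ := by linarith [(abs_le.1 c2).2]
    calc ‖(g' - ‖g'‖ • φ'.smulRight u') * h‖ ≤ κ * G * ((1 + ρ) * ‖w‖) :=
          (norm_mul_le _ _).trans (mul_le_mul hr' hhn (norm_nonneg _) (by positivity))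
      _ ≤ ρ * (G * ((ε - 2 * κ - ρ) * ‖w‖)) := by
          have h2 : ε / 2 * (1 + ρ) ≤ ε - 2 * κ - ρ := by
            have : ε * ρ ≤ 1 * ρ := mul_le_mul_of_nonneg_right hε1 hρ0
            linarith
          have h3 : κ = ρ * (ε / 2) := by linarith
          calc κ * G * ((1 + ρ) * ‖w‖) = ρ * (G * ((ε / 2 * (1 + ρ)) * ‖w‖)) := by
                rw [h3]; ring
            _ ≤ _ := by gcongr
      _ ≤ ρ * ‖w'‖ := mul_le_mul_of_nonneg_left hlow hρ0
  · exact avalanche_log hw hg hg' hε hε1 hκ0 hκ ha1 c1 c2 c3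

/-- **Avalanche principle.** Along a chain of operators that are nearly of rank one and whose
consecutive products do not lose too much norm, the logarithm of the norm of the product is almost
additive. -/
theorem avalanche_principle {g h : ℕ → E →L[ℝ] E} {κ ε : ℝ} (hε : 0 < ε) (hκ0 : 0 ≤ κ)
    (hκ : κ ≤ ε ^ 2 / 100) (n : ℕ) (h0 : h 0 = g 0) (hs : ∀ i, h (i + 1) = g (i + 1) * h i)
    (hpos : ∀ i ≤ n, 0 < ‖g i‖)
    (hr : ∀ i ≤ n, ∃ (φ : E →L[ℝ] ℝ) (u : E), ‖φ‖ = 1 ∧ ‖u‖ = 1 ∧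
      ‖g i - ‖g i‖ • φ.smulRight u‖ ≤ κ * ‖g i‖)
    (hang : ∀ i < n, ε * (‖g (i + 1)‖ * ‖g i‖) ≤ ‖g (i + 1) * g i‖) :
    |Real.log ‖h n‖ - Real.log ‖g 0‖ -
        ∑ i ∈ Finset.range n, (Real.log ‖g (i + 1) * g i‖ - Real.log ‖g i‖)|
      ≤ 16 * n * (κ / ε ^ 2) := by
  choose! φ u hφ hu hr using hr
  rcases Nat.eq_zero_or_pos n with rfl | hn
  · simp [h0]
  have hε1 : ε ≤ 2 := by
    have h1 := (hang 0 hn).trans (norm_mul_le _ _)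
    have h2 : 0 < ‖g (0 + 1)‖ * ‖g 0‖ := mul_pos (hpos _ hn) (hpos _ hn.le)
    nlinarith
  have key : ∀ k ≤ n, (∃ w : E →L[ℝ] ℝ, 0 < ‖w‖ ∧
      ‖h k - w.smulRight (u k)‖ ≤ 2 * κ / ε * ‖w‖) ∧
      |Real.log ‖h k‖ - Real.log ‖g 0‖ -
        ∑ i ∈ Finset.range k, (Real.log ‖g (i + 1) * g i‖ - Real.log ‖g i‖)|
      ≤ 16 * k * (κ / ε ^ 2) := by
    intro k
    induction k with
    | zero =>
      intro _
      have hp := hpos 0 (Nat.zero_le _)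
      refine ⟨⟨‖g 0‖ • φ 0, by rw [norm_smul, hφ 0 (Nat.zero_le _)]; simpa using hp, ?_⟩, by
        simp [h0]⟩
      have h2 : (‖g 0‖ • φ 0).smulRight (u 0) = ‖g 0‖ • (φ 0).smulRight (u 0) := by
        ext x; simp [mul_smul]
      rw [h2, h0, norm_smul, hφ 0 (Nat.zero_le _), norm_norm, mul_one]
      refine (hr 0 (Nat.zero_le _)).trans (mul_le_mul_of_nonneg_right ?_ hp.le)
      rw [le_div_iff₀ hε]
      nlinarith
    | succ k ih =>
      intro hk
      obtain ⟨⟨w, hw, hhw⟩, ihl⟩ := ih (by omega)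
      have hk' : k ≤ n := by omega
      have hst := avalanche_step (hpos k hk') (hpos (k + 1) hk) hw (hφ k hk') (hφ (k + 1) hk)
        (hu k hk') (hu (k + 1) hk) hε hκ0 hκ (hr k hk') (hr (k + 1) hk) (hang k hk) hhw
      rw [← hs] at hst
      refine ⟨hst.1, ?_⟩
      rw [Finset.sum_range_succ]
      have h3 := hst.2
      push_cast
      rw [abs_le] at h3 ihl ⊢
      constructor <;> linarith
  exact (key n le_rfl).2

end Avalanche

/-! ### Iterates of a cocycle -/

section Iterates

variable {X : Type*} {m : ℕ} {T : X → X} {A B : X → Matrix (Fin m) (Fin m) ℝ}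

lemma iter_add (p q : ℕ) (x : X) :
    iter T A (p + q) x = iter T A p (T^[q] x) * iter T A q x := by
  induction p with
  | zero => simp [iter]
  | succ p ih =>
    rw [Nat.add_right_comm, iter, iter, ih, Function.iterate_add_apply, Matrix.mul_assoc]

lemma iter_wedge (k n : ℕ) (x : X) :
    iter T (fun x => wedge k (A x)) n x = wedge k (iter T A n x) := by
  induction n with
  | zero => exact (wedge_one k).symm
  | succ n ih => rw [iter, iter, ih, wedge_mul]

lemma opNorm_iter_le {R : ℝ} (hR : 0 ≤ R) {x : X} (h : ∀ k, opNorm (A (T^[k] x)) ≤ R) (n : ℕ) :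
    opNorm (iter T A n x) ≤ R ^ n := by
  induction n with
  | zero => simpa [iter] using opNorm_one_le
  | succ n ih =>
    rw [iter, pow_succ']
    exact (opNorm_mul_le _ _).trans (mul_le_mul (h n) ih (opNorm_nonneg _) hR)

lemma opNorm_iter_sub_le {R d : ℝ} (hR : 1 ≤ R) (hd : 0 ≤ d) {x : X}
    (hA : ∀ k, opNorm (A (T^[k] x)) ≤ R) (hB : ∀ k, opNorm (B (T^[k] x)) ≤ R)
    (h : ∀ k, opNorm (B (T^[k] x) - A (T^[k] x)) ≤ d) (n : ℕ) :
    opNorm (iter T B n x - iter T A n x) ≤ n * R ^ n * d := by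
  induction n with
  | zero => simp [iter, opNorm]
  | succ n ih =>
    have h1 : iter T B (n + 1) x - iter T A (n + 1) x =
        B (T^[n] x) * (iter T B n x - iter T A n x) +
          (B (T^[n] x) - A (T^[n] x)) * iter T A n x := by
      simp only [iter]; noncomm_ring
    rw [h1]
    have hR0 : 0 ≤ R := by linarith
    have e1 : opNorm (B (T^[n] x) * (iter T B n x - iter T A n x)) ≤ R * (n * R ^ n * d) :=
      (opNorm_mul_le _ _).trans (mul_le_mul (hB n) ih (opNorm_nonneg _) hR0)
    have e2 : opNorm ((B (T^[n] x) - A (T^[n] x)) * iter T A n x) ≤ d * R ^ n :=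
      (opNorm_mul_le _ _).trans
        (mul_le_mul (h n) (opNorm_iter_le hR0 hA n) (opNorm_nonneg _) hd)
    have e3 : d * R ^ n ≤ R * (d * R ^ n) := le_mul_of_one_le_left (by positivity) hR
    refine (opNorm_add_le _ _).trans ((add_le_add e1 e2).trans ?_)
    push_cast
    rw [pow_succ]
    nlinarith

variable [MeasurableSpace X] {μ : Measure X}

lemma measurable_iter_apply (hT : Measurable T) (hA : ∀ i j, Measurable fun x => A x i j) (n : ℕ) :
    ∀ i j, Measurable fun x => iter T A n x i j := by
  induction n with
  | zero => intro i j; exact measurable_const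
  | succ n ih =>
    intro i j
    simp only [iter, Matrix.mul_apply]
    exact Finset.measurable_sum _ fun k _ => ((hA i k).comp (hT.iterate n)).mul (ih k j)

lemma measurable_opNorm {F : X → Matrix (Fin m) (Fin m) ℝ}
    (hF : ∀ i j, Measurable fun x => F x i j) : Measurable fun x => opNorm (F x) := by
  have h : Continuous fun M : Fin m → Fin m → ℝ => opNorm (Matrix.of M) := continuous_opNorm
  exact h.measurable.comp (measurable_pi_lambda _ fun i => measurable_pi_lambda _ fun j => hF i j)

lemma measurable_opNorm_iter (hT : Measurable T) (hA : ∀ i j, Measurable fun x => A x i j) (n : ℕ) :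
    Measurable fun x => opNorm (iter T A n x) :=
  measurable_opNorm (measurable_iter_apply hT hA n)

lemma ae_orbit (hT : MeasurePreserving T μ μ) {p : X → Prop} (h : ∀ᵐ x ∂μ, p x) :
    ∀ᵐ x ∂μ, ∀ k, p (T^[k] x) :=
  ae_all_iff.2 fun k => (hT.iterate k).quasiMeasurePreserving.ae h

end Iterates

/-! ### Extended expectations of logarithms -/

section Expect

variable {X : Type*} [MeasurableSpace X] {μ : Measure X}

lemma scaledLog_of_pos (n : ℕ) {r : ℝ} (hr : 0 < r) :
    scaledLog n r = ((1 / (n : ℝ) * Real.log r : ℝ) : EReal) := by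
  rw [scaledLog, ENNReal.log_ofReal_of_pos hr, EReal.coe_mul]

lemma scaledLog_of_nonpos {n : ℕ} (hn : 1 ≤ n) {r : ℝ} (hr : r ≤ 0) : scaledLog n r = ⊥ := by
  rw [scaledLog, ENNReal.log_ofReal, if_pos hr]
  have : (0 : ℝ) < n := by exact_mod_cast hn
  exact EReal.coe_mul_bot_of_pos (by positivity)

lemma scaledLog_mono (n : ℕ) {r s : ℝ} (h : r ≤ s) : scaledLog n r ≤ scaledLog n s := by
  rw [scaledLog, scaledLog]
  refine mul_le_mul_of_nonneg_left ?_ (by exact_mod_cast (by positivity : (0 : ℝ) ≤ 1 / n))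
  exact ENNReal.log_monotone (ENNReal.ofReal_le_ofReal h)

lemma expect_mono {f g : X → EReal} (h : ∀ x, f x ≤ g x) : expect μ f ≤ expect μ g := by
  refine EReal.sub_le_sub ?_ ?_
  · exact_mod_cast lintegral_mono fun x => EReal.toENNReal_le_toENNReal (h x)
  · exact_mod_cast lintegral_mono fun x =>
      EReal.toENNReal_le_toENNReal (EReal.neg_le_neg_iff.2 (h x))

lemma expect_eq_integral {f : X → EReal} {v : X → ℝ} (hv : Integrable v μ)
    (h : ∀ᵐ x ∂μ, f x = v x) : expect μ f = ((∫ x, v x ∂μ : ℝ) : EReal) := by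
  have h1 : ∫⁻ x, (f x).toENNReal ∂μ = ∫⁻ x, ENNReal.ofReal (v x) ∂μ :=
    lintegral_congr_ae (h.mono fun x hx => by dsimp only; rw [hx, EReal.real_coe_toENNReal])
  have h2 : ∫⁻ x, (-f x).toENNReal ∂μ = ∫⁻ x, ENNReal.ofReal (-v x) ∂μ :=
    lintegral_congr_ae (h.mono fun x hx => by
      dsimp only; rw [hx, ← EReal.coe_neg, EReal.real_coe_toENNReal])
  have f1 : ∫⁻ x, ENNReal.ofReal (v x) ∂μ ≠ ⊤ := hv.lintegral_lt_top.ne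
  have f2 : ∫⁻ x, ENNReal.ofReal (-v x) ∂μ ≠ ⊤ := hv.neg.lintegral_lt_top.ne
  rw [expect, h1, h2, integral_eq_lintegral_pos_part_sub_lintegral_neg_part hv, EReal.coe_sub,
    EReal.coe_ennreal_toReal f1, EReal.coe_ennreal_toReal f2]

/-- If the extended expectation of `(1/n) log f` is less than `c`, possibly `-∞`, then so is the
integral of some integrable real majorant of `(1/n) log f`, namely of a truncation. -/
lemma exists_integrable_majorant [IsProbabilityMeasure μ] {n : ℕ} (hn : 1 ≤ n) {f : X → ℝ}
    (hf : Measurable f) {R : ℝ} (hR : ∀ᵐ x ∂μ, f x ≤ R) {c : ℝ}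
    (h : expect μ (fun x => scaledLog n (f x)) < c) :
    ∃ l : X → ℝ, Integrable l μ ∧ (∀ x, f x ≤ Real.exp (n * l x)) ∧ ∫ x, l x ∂μ < c := by
  have hn0 : (0 : ℝ) < n := by exact_mod_cast hn
  set F : X → EReal := fun x => scaledLog n (f x) with hF
  set l : ℕ → X → ℝ := fun j x => 1 / (n : ℝ) * Real.log (max (f x) (Real.exp (-(j * n)))) with hl
  have hlm : ∀ j, Measurable (l j) := fun j =>
    (Real.measurable_log.comp (hf.max measurable_const)).const_mul _
  have hmaxpos : ∀ j x, 0 < max (f x) (Real.exp (-((j : ℕ) * n : ℝ))) := fun j x =>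
    lt_max_of_lt_right (Real.exp_pos _)
  have hlow : ∀ (j : ℕ) x, -(j : ℝ) ≤ l j x := by
    intro j x
    have h1 : Real.log (Real.exp (-((j : ℕ) * n : ℝ))) ≤
        Real.log (max (f x) (Real.exp (-((j : ℕ) * n : ℝ)))) :=
      Real.log_le_log (Real.exp_pos _) (le_max_right _ _)
    rw [Real.log_exp] at h1
    simp only [hl]
    rw [one_div, ← div_eq_inv_mul, le_div_iff₀ hn0]
    linarith
  have hexp : ∀ j x, f x ≤ Real.exp (n * l j x) := by
    intro j x
    simp only [hl]
    rw [← mul_assoc, mul_one_div_cancel hn0.ne', one_mul, Real.exp_log (hmaxpos j x)]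
    exact le_max_left _ _
  have hint : ∀ j, Integrable (l j) μ := by
    intro j
    refine Integrable.of_bound (hlm j).aestronglyMeasurable
      (j + 1 / (n : ℝ) * |Real.log (max R (Real.exp (-(j * n))))|) ?_
    filter_upwards [hR] with x hx
    have h1 : l j x ≤ 1 / (n : ℝ) * |Real.log (max R (Real.exp (-(j * n))))| := by
      refine mul_le_mul_of_nonneg_left (le_trans ?_ (le_abs_self _)) (by positivity)
      exact Real.log_le_log (hmaxpos j x) (max_le_max_right _ hx)
    have h2 := hlow j x
    have h3 : (0 : ℝ) ≤ j := Nat.cast_nonneg j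
    have h4 : 0 ≤ 1 / (n : ℝ) * |Real.log (max R (Real.exp (-(j * n))))| := by positivity
    rw [Real.norm_eq_abs, abs_le]
    constructor <;> linarith
  -- the positive parts agree with those of `F`, and the negative parts increase to those of `F`
  have hcase : ∀ j x, (0 < f x ∧ F x = ((1 / (n : ℝ) * Real.log (f x) : ℝ) : EReal) ∧
      l j x = max (1 / (n : ℝ) * Real.log (f x)) (-j)) ∨ (F x = ⊥ ∧ l j x = -j) := by
    intro j x
    have hj : 1 / (n : ℝ) * Real.log (Real.exp (-((j : ℕ) * n : ℝ))) = -j := by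
      rw [Real.log_exp]; field_simp
    rcases lt_or_ge 0 (f x) with hx | hx
    · refine Or.inl ⟨hx, scaledLog_of_pos n hx, ?_⟩
      rcases le_total (f x) (Real.exp (-((j : ℕ) * n : ℝ))) with h1 | h1
      · have h2 : 1 / (n : ℝ) * Real.log (f x) ≤ -j := by
          rw [← hj]
          exact mul_le_mul_of_nonneg_left (Real.log_le_log hx h1) (by positivity)
        simp only [hl]; rw [max_eq_right h1, hj, max_eq_right h2]
      · have h2 : -(j : ℝ) ≤ 1 / (n : ℝ) * Real.log (f x) := by
          rw [← hj]
          exact mul_le_mul_of_nonneg_left (Real.log_le_log (Real.exp_pos _) h1) (by positivity)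
        simp only [hl]; rw [max_eq_left h1, max_eq_left h2]
    · refine Or.inr ⟨scaledLog_of_nonpos hn hx, ?_⟩
      simp only [hl]; rw [max_eq_right (hx.trans (Real.exp_pos _).le), hj]
  have hposp : ∀ j x, ENNReal.ofReal (l j x) = (F x).toENNReal := by
    intro j x
    have h3 : (0 : ℝ) ≤ j := Nat.cast_nonneg j
    rcases hcase j x with ⟨_, h1, h2⟩ | ⟨h1, h2⟩
    · rw [h1, h2, EReal.real_coe_toENNReal, ENNReal.ofReal_max,
        ENNReal.ofReal_of_nonpos (by linarith : -(j : ℝ) ≤ 0)]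
      simp
    · rw [h1, h2, EReal.toENNReal_bot, ENNReal.ofReal_of_nonpos (by linarith)]
  have hnegp : ∀ x, ⨆ j, ENNReal.ofReal (-l j x) = (-F x).toENNReal := by
    intro x
    rcases hcase 0 x with ⟨hx, h1, -⟩ | ⟨h1, -⟩
    · have h2 : ∀ j, l j x = max (1 / (n : ℝ) * Real.log (f x)) (-j) := by
        intro j
        rcases hcase j x with ⟨_, _, h2⟩ | ⟨h2, _⟩
        · exact h2
        · rw [h1] at h2; exact absurd h2 (EReal.coe_ne_bot _)
      rw [h1, ← EReal.coe_neg, EReal.real_coe_toENNReal]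
      apply le_antisymm
      · refine iSup_le fun j => ENNReal.ofReal_le_ofReal ?_
        rw [h2, neg_le_neg_iff]; exact le_max_left _ _
      · obtain ⟨j, hj⟩ := exists_nat_ge (-(1 / (n : ℝ) * Real.log (f x)))
        refine le_iSup_of_le j (ENNReal.ofReal_le_ofReal ?_)
        rw [h2, max_eq_left (by linarith)]
    · have h2 : ∀ j, l j x = -j := by
        intro j
        rcases hcase j x with ⟨_, h2, _⟩ | ⟨_, h2⟩
        · rw [h1] at h2; exact absurd h2.symm (EReal.coe_ne_bot _)
        · exact h2
      rw [h1, EReal.neg_bot, EReal.toENNReal_top]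
      simp only [h2, neg_neg, ENNReal.ofReal_natCast]
      exact ENNReal.iSup_natCast
  have hmono : Monotone fun j x => ENNReal.ofReal (-l j x) := by
    intro i j hij x
    refine ENNReal.ofReal_le_ofReal (neg_le_neg ?_)
    refine mul_le_mul_of_nonneg_left (Real.log_le_log (hmaxpos j x) (max_le_max_left _ ?_))
      (by positivity)
    refine Real.exp_le_exp.2 (neg_le_neg (mul_le_mul_of_nonneg_right ?_ hn0.le))
    exact_mod_cast hij
  have hQ : ∫⁻ x, (-F x).toENNReal ∂μ = ⨆ j, ∫⁻ x, ENNReal.ofReal (-l j x) ∂μ := by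
    rw [← lintegral_iSup (f := fun j x => ENNReal.ofReal (-l j x))
      (fun j => ENNReal.measurable_ofReal.comp (hlm j).neg) hmono]
    exact lintegral_congr fun x => (hnegp x).symm
  set P := ∫⁻ x, (F x).toENNReal ∂μ with hP
  have hPj : ∀ j, P = ∫⁻ x, ENNReal.ofReal (l j x) ∂μ := fun j =>
    lintegral_congr fun x => (hposp j x).symm
  have hPfin : P ≠ ⊤ := by rw [hPj 0]; exact (hint 0).lintegral_lt_top.ne
  have hval : ∀ j, ∫ x, l j x ∂μ = P.toReal - (∫⁻ x, ENNReal.ofReal (-l j x) ∂μ).toReal := by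
    intro j
    rw [integral_eq_lintegral_pos_part_sub_lintegral_neg_part (hint j), ← hPj j]
  by_contra hcon
  push Not at hcon
  have hcj : ∀ j, c ≤ P.toReal - (∫⁻ x, ENNReal.ofReal (-l j x) ∂μ).toReal := fun j => by
    rw [← hval j]; exact hcon (l j) (hint j) (hexp j)
  have hQle : ∫⁻ x, (-F x).toENNReal ∂μ ≤ ENNReal.ofReal (P.toReal - c) := by
    rw [hQ]
    refine iSup_le fun j => ?_
    have hfin : ∫⁻ x, ENNReal.ofReal (-l j x) ∂μ ≠ ⊤ := (hint j).neg.lintegral_lt_top.ne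
    rw [← ENNReal.ofReal_toReal hfin]
    exact ENNReal.ofReal_le_ofReal (by linarith [hcj j])
  have hPc : 0 ≤ P.toReal - c := by
    have := hcj 0
    have h2 : 0 ≤ (∫⁻ x, ENNReal.ofReal (-l 0 x) ∂μ).toReal := ENNReal.toReal_nonneg
    linarith
  have : (c : EReal) ≤ expect μ F := by
    have e1 : ((P.toReal : ℝ) : EReal) = (P : EReal) := EReal.coe_ennreal_toReal hPfin
    have e2 : ((∫⁻ x, (-F x).toENNReal ∂μ : ℝ≥0∞) : EReal) ≤ ((P.toReal - c : ℝ) : EReal) := by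
      refine (EReal.coe_ennreal_le_coe_ennreal_iff.2 hQle).trans ?_
      rw [EReal.coe_ennreal_ofReal, max_eq_left hPc]
    calc (c : EReal) = ((P.toReal : ℝ) : EReal) - ((P.toReal - c : ℝ) : EReal) := by
          rw [← EReal.coe_sub]; congr 1; ring
      _ ≤ expect μ F := by
          rw [expect, ← hP, ← e1]
          exact EReal.sub_le_sub le_rfl e2
  exact absurd h (not_lt.2 this)

end Expect

/-! ### Uniform upper large deviations for the norms of the iterates -/

section UpperDeviations

section Deterministic

variable {X : Type*} {m : ℕ} {T : X → X} {A : X → Matrix (Fin m) (Fin m) ℝ}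

lemma opNorm_iter_mul_le {N : ℕ} {G : X → ℝ} {x : X}
    (hG : ∀ k, opNorm (iter T A N (T^[k] x)) ≤ Real.exp (N * G (T^[k] x))) (r q : ℕ) :
    opNorm (iter T A (q * N) (T^[r] x)) ≤
      Real.exp (N * ∑ k ∈ Finset.range q, G (T^[r + k * N] x)) := by
  induction q with
  | zero => simpa [iter] using opNorm_one_le
  | succ q ih =>
    have h1 : (q + 1) * N = N + q * N := by ring
    rw [h1, iter_add, Finset.sum_range_succ, mul_add, Real.exp_add, mul_comm (Real.exp _)]
    refine (opNorm_mul_le _ _).trans (mul_le_mul ?_ ih (opNorm_nonneg _) (Real.exp_pos _).le)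
    rw [← Function.iterate_add_apply, add_comm (q * N) r]
    exact hG _

/-- If the `N`-step norms along an orbit are bounded by `exp (N G)`, the `n`-step norms are bounded
by the exponential of the Birkhoff sum of `G`, up to a boundary term that does not depend on `n`.
The orbit segment is cut into blocks of length `N`, and the starting offset `r < N` is chosen by the
pigeonhole principle so that the corresponding sum of `G` is at most average. -/
lemma opNorm_iter_le_exp_sum {N : ℕ} (hN : 1 ≤ N) {G : X → ℝ} {M t : ℝ} (hM : 0 ≤ M)
    {x : X} (hA : ∀ k, opNorm (A (T^[k] x)) ≤ Real.exp M)
    (hG : ∀ k, opNorm (iter T A N (T^[k] x)) ≤ Real.exp (N * G (T^[k] x)))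
    (ht : 0 ≤ t) (hGt : ∀ y, -t ≤ G y) {n : ℕ} (hn : N ≤ n) :
    opNorm (iter T A n x) ≤
      Real.exp (2 * N * (M + t) + ∑ j ∈ Finset.range n, G (T^[j] x)) := by
  obtain ⟨q, s, hs, hqs⟩ : ∃ q s, s < N ∧ n = q * N + (N + s) := by
    refine ⟨n / N - 1, n % N, Nat.mod_lt _ hN, ?_⟩
    have h1 := Nat.div_add_mod n N
    have h2 : 1 ≤ n / N := (Nat.one_le_div_iff hN).2 hn
    generalize n / N = a at h1 h2 ⊢
    generalize n % N = s at h1 ⊢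
    obtain ⟨k, rfl⟩ := Nat.exists_eq_add_of_le h2
    rw [Nat.add_sub_cancel_left, ← h1]
    ring
  set S := ∑ j ∈ Finset.range (q * N), G (T^[j] x) with hS
  have hN0 : (0 : ℝ) < N := by exact_mod_cast hN
  have hsum : ∑ r ∈ Finset.range N, ∑ k ∈ Finset.range q, G (T^[r + k * N] x) = S := by
    rw [Finset.sum_comm, hS]
    clear hqs hS S
    induction q with
    | zero => simp
    | succ q ih =>
      rw [Finset.sum_range_succ, ih, Nat.succ_mul, Finset.sum_range_add]
      congr 1
      exact Finset.sum_congr rfl fun r _ => by rw [add_comm]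
  obtain ⟨r, hr, hrS⟩ : ∃ r ∈ Finset.range N,
      ∑ k ∈ Finset.range q, G (T^[r + k * N] x) ≤ S / N := by
    apply Finset.exists_le_of_sum_le ⟨0, Finset.mem_range.2 hN⟩
    rw [hsum, Finset.sum_const, Finset.card_range, nsmul_eq_mul, mul_div_cancel₀ _ hN0.ne']
  have hrN : r < N := Finset.mem_range.1 hr
  have hpow : ∀ y k, (∀ k, opNorm (A (T^[k] y)) ≤ Real.exp M) →
      opNorm (iter T A k y) ≤ Real.exp (M * k) := fun y k h => by
    rw [mul_comm, Real.exp_nat_mul]; exact opNorm_iter_le (Real.exp_pos _).le h k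
  have h1 : opNorm (iter T A n x) ≤ Real.exp (M * (N + s - r : ℕ)) * (Real.exp S *
      Real.exp (M * r)) := by
    have hn' : n = (N + s - r) + (q * N + r) := by omega
    rw [hn', iter_add, iter_add]
    refine (opNorm_mul_le _ _).trans (mul_le_mul ?_ ((opNorm_mul_le _ _).trans
      (mul_le_mul ?_ ?_ (opNorm_nonneg _) (Real.exp_pos _).le)) (opNorm_nonneg _)
      (Real.exp_pos _).le)
    · refine hpow _ _ fun k => ?_
      rw [← Function.iterate_add_apply]; exact hA _
    · refine (opNorm_iter_mul_le hG r q).trans (Real.exp_le_exp.2 ?_)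
      rw [← mul_div_cancel₀ S hN0.ne', mul_comm (N : ℝ)]
      rw [le_div_iff₀ hN0] at hrS
      have : S / N * N = S := div_mul_cancel₀ _ hN0.ne'
      field_simp
      linarith
    · exact hpow _ _ hA
  refine h1.trans ?_
  rw [← Real.exp_add, ← Real.exp_add]
  refine Real.exp_le_exp.2 ?_
  have h2 : ∑ j ∈ Finset.range n, G (T^[j] x) =
      S + ∑ j ∈ Finset.range (N + s), G (T^[q * N + j] x) := by
    rw [hqs, Finset.sum_range_add]
  have h3 : -(2 * N * t) ≤ ∑ j ∈ Finset.range (N + s), G (T^[q * N + j] x) := by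
    have h4 := Finset.card_nsmul_le_sum (Finset.range (N + s))
      (fun j => G (T^[q * N + j] x)) (-t) fun j _ => hGt _
    rw [Finset.card_range, nsmul_eq_mul] at h4
    have h5 : ((N + s : ℕ) : ℝ) ≤ 2 * N := by
      have : N + s ≤ 2 * N := by omega
      exact_mod_cast this
    nlinarith
  have h6 : M * ((N + s - r : ℕ) : ℝ) + M * r ≤ 2 * N * M := by
    rw [← mul_add, ← Nat.cast_add]
    have h5 : ((N + s - r + r : ℕ) : ℝ) ≤ 2 * N := by
      have : N + s - r + r ≤ 2 * N := by omega
      exact_mod_cast this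
    nlinarith
  linarith

lemma min_le_count_le {z : ℝ} (hz : 0 ≤ z) (k : ℕ) :
    min z k ≤ ∑ i ∈ Finset.range k, (if (i : ℝ) ≤ z then (1 : ℝ) else 0) ∧
      ∑ i ∈ Finset.range k, (if (i : ℝ) ≤ z then (1 : ℝ) else 0) ≤ min (k : ℝ) (z + 1) := by
  induction k with
  | zero => simpa using by linarith
  | succ k ih =>
    rw [Finset.sum_range_succ]
    push_cast
    obtain ⟨h1, h2⟩ := ih
    rw [le_min_iff] at h2
    split_ifs with h
    · rw [min_eq_right h] at h1
      exact ⟨(min_le_right _ _).trans (by linarith), le_min (by linarith) (by linarith)⟩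
    · push Not at h
      rw [min_eq_left h.le] at h1
      exact ⟨(min_le_left _ _).trans (by linarith), le_min (by linarith) (by linarith)⟩

/-- The logarithm of `max y τ` is, up to an error `s`, a step function counting the levels
`τ e^{si}` that lie below `y`. -/
lemma log_max_le_count {y τ s : ℝ} (hτ : 0 < τ) (hs : 0 < s) {k : ℕ}
    (hk : y ≤ τ * Real.exp (s * k)) :
    Real.log (max y τ) ≤ Real.log τ +
        s * ∑ i ∈ Finset.range k, (if τ * Real.exp (s * i) ≤ y then (1 : ℝ) else 0) ∧
      Real.log τ + s * ∑ i ∈ Finset.range k, (if τ * Real.exp (s * i) ≤ y then (1 : ℝ) else 0)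
        ≤ Real.log (max y τ) + s := by
  rcases lt_or_ge y τ with hy | hy
  · have : ∀ i ∈ Finset.range k, (if τ * Real.exp (s * i) ≤ y then (1 : ℝ) else 0) = 0 := by
      intro i _
      rw [if_neg]
      push Not
      refine hy.trans_le (le_mul_of_one_le_right hτ.le (Real.one_le_exp (by positivity)))
    rw [Finset.sum_eq_zero this, max_eq_right hy.le]
    constructor <;> linarith
  · have hy0 : 0 < y := hτ.trans_le hy
    set z := (Real.log y - Real.log τ) / s with hz
    have hz0 : 0 ≤ z := div_nonneg (sub_nonneg.2 (Real.log_le_log hτ hy)) hs.le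
    have hiff : ∀ i : ℕ, τ * Real.exp (s * i) ≤ y ↔ (i : ℝ) ≤ z := by
      intro i
      rw [hz, le_div_iff₀ hs, ← Real.log_le_log_iff (by positivity) hy0,
        Real.log_mul hτ.ne' (Real.exp_pos _).ne', Real.log_exp]
      constructor <;> intro h <;> linarith
    have hzk : z ≤ k := by
      rw [hz, div_le_iff₀ hs]
      have := Real.log_le_log hy0 hk
      rw [Real.log_mul hτ.ne' (Real.exp_pos _).ne', Real.log_exp] at this
      linarith
    simp only [hiff]
    obtain ⟨h1, h2⟩ := min_le_count_le hz0 k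
    rw [min_eq_left hzk] at h1
    have h3 := h2.trans (min_le_right _ _)
    have h4 : s * z = Real.log y - Real.log τ := by rw [hz]; field_simp
    rw [max_eq_left hy]
    constructor <;> nlinarith

end Deterministic

variable {X : Type*} [MeasurableSpace X] {μ : Measure X} {T : X → X}

/-- Finitely many observables satisfy a common base-LDT estimate, because deviation set measure
functions form a cone. -/
lemma exists_common_baseLDT {P : LDTSystem} {Ξ : Set (X → ℝ)} (hbase : ∀ ξ ∈ Ξ, BaseLDT μ T P ξ)
    {ε : ℝ} (hε : 0 < ε) (ξ : ℕ → X → ℝ) (hξ : ∀ i, ξ i ∈ Ξ) (k : ℕ) :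
    ∃ n₀ : ℕ, ∃ f ∈ P.measures, ∀ n, n₀ ≤ n →
      μ {x | ∃ i < k + 1, ε <
        |(1 / (n : ℝ)) * ∑ j ∈ Finset.range n, ξ i (T^[j] x) - ∫ y, ξ i y ∂μ|}
        ≤ ENNReal.ofReal (f n) := by
  have single : ∀ i, ∃ p ∈ P.params, ∀ n, p.scale ≤ n →
      μ {x | ε < |(1 / (n : ℝ)) * ∑ j ∈ Finset.range n, ξ i (T^[j] x) - ∫ y, ξ i y ∂μ|}
        ≤ ENNReal.ofReal (p.mes n) := by
    intro i
    obtain ⟨p, hp, h⟩ := hbase (ξ i) (hξ i) ε hε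
    refine ⟨p, hp, fun n hn => ?_⟩
    obtain ⟨h1, h2⟩ := h n hn
    exact (measure_mono fun x hx => lt_of_le_of_lt h1 hx).trans h2.le
  induction k with
  | zero =>
    obtain ⟨p, hp, h⟩ := single 0
    refine ⟨p.scale, p.mes, P.mes_mem p hp, fun n hn => ?_⟩
    simpa using h n hn
  | succ k ih =>
    obtain ⟨n₀, f, hf, ih⟩ := ih
    obtain ⟨p, hp, h⟩ := single (k + 1)
    refine ⟨max n₀ p.scale, _, P.add_mem f hf p.mes (P.mes_mem p hp), fun n hn => ?_⟩
    have hn1 : (0 : ℝ) < n := by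
      exact_mod_cast (P.scale_pos p hp).trans ((le_max_right _ _).trans hn)
    rw [ENNReal.ofReal_add ((P.isDeviationMeasure f hf).pos n hn1).le
      ((P.isDeviationMeasure _ (P.mes_mem p hp)).pos n hn1).le]
    refine le_trans (measure_mono ?_) ((measure_union_le _ _).trans
      (add_le_add (ih n ((le_max_left _ _).trans hn)) (h n ((le_max_right _ _).trans hn))))
    rintro x ⟨i, hi, hx⟩
    rcases Nat.lt_succ_iff_lt_or_eq.1 hi with h1 | rfl
    · exact Or.inl ⟨i, h1, hx⟩
    · exact Or.inr hx

lemma exists_integral_max_lt {l : X → ℝ} (hl : Integrable l μ) {c : ℝ} (hc : ∫ x, l x ∂μ < c) :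
    ∃ t : ℕ, ∫ x, max (l x) (-t) ∂μ < c := by
  have h : Tendsto (fun t : ℕ => ∫ x, max (l x) (-(t : ℝ)) ∂μ) atTop (𝓝 (∫ x, l x ∂μ)) := by
    refine tendsto_integral_of_dominated_convergence (fun x => |l x|) (fun t => ?_) hl.abs
      (fun t => ?_) ?_
    · exact (hl.aestronglyMeasurable.sup aestronglyMeasurable_const)
    · refine Eventually.of_forall fun x => ?_
      rw [Real.norm_eq_abs, abs_le]
      have h0 : (0 : ℝ) ≤ t := Nat.cast_nonneg t
      constructor
      · exact (neg_abs_le _).trans (le_max_left _ _)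
      · exact max_le (le_abs_self _) (by linarith [abs_nonneg (l x)])
    · refine Eventually.of_forall fun x => ?_
      obtain ⟨t₀, ht₀⟩ := exists_nat_ge (-l x)
      refine tendsto_const_nhds.congr' ?_
      filter_upwards [eventually_ge_atTop t₀] with t ht
      have : (t₀ : ℝ) ≤ t := by exact_mod_cast ht
      rw [max_eq_left (by linarith)]
  exact ((h.eventually (gt_mem_nhds hc)).exists)

lemma ae_opNorm_le {C : CocycleSpace μ} {d : ℕ} (W : C.Dim d) :
    ∃ M : ℝ, 0 ≤ M ∧ ∀ᵐ x ∂μ, opNorm (W.fn x) ≤ Real.exp M := by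
  have h := C.bounded d W.1 W.2
  have hfin : eLpNorm (fun x => opNorm (W.fn x)) ∞ μ ≠ ⊤ := h.eLpNorm_lt_top.ne
  set R := (eLpNorm (fun x => opNorm (W.fn x)) ∞ μ).toReal with hR
  have hR0 : 0 ≤ R := ENNReal.toReal_nonneg
  refine ⟨R, hR0, ?_⟩
  rw [eLpNorm_exponent_top] at hfin hR
  filter_upwards [enorm_ae_le_eLpNormEssSup (fun x => opNorm (W.fn x)) μ] with x hx
  have h1 : opNorm (W.fn x) ≤ R := by
    have h2 := ENNReal.toReal_mono hfin hx
    rwa [toReal_enorm, Real.norm_eq_abs, abs_of_nonneg (opNorm_nonneg _), ← hR] at h2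
  linarith [Real.add_one_le_exp R]

lemma ae_opNorm_sub_le {C : CocycleSpace μ} {d : ℕ} (V W : C.Dim d) :
    ∀ᵐ x ∂μ, opNorm (V.fn x - W.fn x) ≤ dist V W := by
  have h : eLpNorm (fun x => opNorm (V.fn x - W.fn x)) ∞ μ ≤ ENNReal.ofReal (dist V W) :=
    C.linfty_le_dist d W V
  rw [eLpNorm_exponent_top] at h
  filter_upwards [enorm_ae_le_eLpNormEssSup (fun x => opNorm (V.fn x - W.fn x)) μ] with x hx
  have h1 := hx.trans h
  rwa [Real.enorm_eq_ofReal (opNorm_nonneg _), ENNReal.ofReal_le_ofReal_iff dist_nonneg] at h1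

/-- A common almost sure bound for all cocycles at distance at most one. -/
lemma exists_uniform_bound {C : CocycleSpace μ} {d : ℕ} (W : C.Dim d) :
    ∃ M : ℝ, 0 ≤ M ∧ ∀ V : C.Dim d, dist V W < 1 → ∀ᵐ x ∂μ, opNorm (V.fn x) ≤ Real.exp M := by
  obtain ⟨M, hM, h⟩ := ae_opNorm_le W
  refine ⟨M + 1, by linarith, fun V hV => ?_⟩
  filter_upwards [h, ae_opNorm_sub_le V W] with x h1 h2
  have h3 := opNorm_le_add_sub (V.fn x) (W.fn x)
  have h4 := Real.add_one_le_exp (1 : ℝ)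
  have h5 := Real.one_le_exp hM
  rw [Real.exp_add]
  nlinarith

/-- **Uniform upper large deviations.** If the expectation of `(1/N) log ‖W^{(N)}‖` at one scale `N`
is less than `c` (in the sense of an integrable majorant), then for all cocycles `V` near `W` and all
large `n` the norm of `V^{(n)}` exceeds `e^{cn}` only on a set of LDT-small measure.

The function `(1/N) log ‖V^{(N)}‖` is bounded, simultaneously for all `V` near `W`, by a positive
combination of indicators of the level sets `{‖W^{(N)}‖ ≥ r}`, hence of observables, and
subadditivity reduces the claim to the base-LDT estimates of these finitely many observables. -/
theorem exists_upper_deviation [IsProbabilityMeasure μ] (hT : MeasurePreserving T μ μ)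
    {C : CocycleSpace μ} {Ξ : Set (X → ℝ)} {P : LDTSystem} (hbase : ∀ ξ ∈ Ξ, BaseLDT μ T P ξ)
    {d : ℕ} (W : C.Dim d) (hW : Compatible μ T Ξ W.fn) {N : ℕ} (hN : 1 ≤ N) {l : X → ℝ}
    (hl : Integrable l μ) (hWl : ∀ᵐ x ∂μ, opNorm (iter T W.fn N x) ≤ Real.exp (N * l x)) {c : ℝ}
    (hc : ∫ x, l x ∂μ < c) :
    ∃ δ : ℝ, 0 < δ ∧ ∃ n₀ : ℕ, ∃ f ∈ P.measures, ∀ V : C.Dim d, dist V W < δ → ∀ n, n₀ ≤ n →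
      μ {x | Real.exp (n * c) < opNorm (iter T V.fn n x)} ≤ ENNReal.ofReal (f n) := by
  have hN0 : (0 : ℝ) < N := by exact_mod_cast hN
  obtain ⟨t, ht⟩ := exists_integral_max_lt hl hc
  obtain ⟨e, he, htc⟩ : ∃ e : ℝ, 0 < e ∧ ∫ x, max (l x) (-t) ∂μ + 5 * e ≤ c :=
    ⟨(c - ∫ x, max (l x) (-t) ∂μ) / 5, by linarith, by linarith⟩
  obtain ⟨M, hM, hbd⟩ := exists_uniform_bound W
  set τ := Real.exp (-(t * N)) with hτ
  have hτ0 : 0 < τ := Real.exp_pos _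
  have hlogτ : Real.log τ = -(t * N) := Real.log_exp _
  set s := N * e with hs
  have hs0 : 0 < s := mul_pos hN0 he
  -- the number of levels
  obtain ⟨k, hk⟩ := exists_nat_ge ((M * N + t * N) / s)
  have hkR : Real.exp (M * N) ≤ τ * Real.exp (s * (k + 1 : ℕ)) := by
    rw [hτ, ← Real.exp_add]
    refine Real.exp_le_exp.2 ?_
    rw [div_le_iff₀ hs0] at hk
    push_cast
    nlinarith
  set F : ℕ → Set X := fun i => {x | τ * Real.exp (s * i) ≤ opNorm (iter T W.fn N x)} with hF
  have hFmem : ∀ i, F i ∈ normAlgebra T W.fn N := fun i =>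
    .base _ ⟨N, le_rfl, τ * Real.exp (s * i), by positivity, Or.inr rfl⟩
  have hWm : Measurable fun x => opNorm (iter T W.fn N x) :=
    measurable_opNorm_iter hT.measurable (C.measurable_entries d W.1 W.2) N
  have hFmeas : ∀ i, MeasurableSet (F i) := fun i => measurableSet_le measurable_const hWm
  set r : ℝ := 1 / (k + 1 : ℕ) with hr
  have hk0 : (0 : ℝ) < (k + 1 : ℕ) := by positivity
  have hr0 : 0 < r := by positivity
  have hkr : ((k + 1 : ℕ) : ℝ) * r = 1 := by rw [hr]; field_simp
  have hobs := fun i => hW N (F i) (hFmem i) r hr0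
  choose ξ hξΞ hξF hξint using hobs
  have hξ0 : ∀ i x, 0 ≤ ξ i x := fun i x =>
    (Set.indicator_nonneg (fun _ _ => zero_le_one) x).trans (hξF i x)
  obtain ⟨n₁, f, hf, hdev⟩ := exists_common_baseLDT hbase hr0 ξ hξΞ k
  set a : ℝ := e - t with ha
  set G : X → ℝ := fun x => a + e * ∑ i ∈ Finset.range (k + 1), ξ i x with hG
  have hGt : ∀ y, -(t : ℝ) ≤ G y := fun y => by
    have : 0 ≤ e * ∑ i ∈ Finset.range (k + 1), ξ i y :=
      mul_nonneg he.le (Finset.sum_nonneg fun i _ => hξ0 i y)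
    simp only [hG, ha]; linarith
  set cnt : X → ℝ := fun x => ∑ i ∈ Finset.range (k + 1),
    (if τ * Real.exp (s * i) ≤ opNorm (iter T W.fn N x) then (1 : ℝ) else 0) with hcnt
  have hcntF : ∀ x, cnt x = ∑ i ∈ Finset.range (k + 1), (F i).indicator (fun _ => (1 : ℝ)) x :=
    fun x => Finset.sum_congr rfl fun i _ => by simp [Set.indicator, hF]
  have hcntξ : ∀ x, cnt x ≤ ∑ i ∈ Finset.range (k + 1), ξ i x := fun x => by
    rw [hcntF]; exact Finset.sum_le_sum fun i _ => hξF i x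
  have hWM : ∀ᵐ x ∂μ, opNorm (iter T W.fn N x) ≤ Real.exp (M * N) := by
    filter_upwards [ae_orbit hT (hbd W (by simp))] with x hx
    rw [mul_comm, Real.exp_nat_mul]
    exact opNorm_iter_le (Real.exp_pos _).le hx N
  -- the integral of the dominating function
  have hint_cnt : Integrable cnt μ := by
    have : cnt = fun x => ∑ i ∈ Finset.range (k + 1), (F i).indicator (fun _ => (1 : ℝ)) x :=
      funext hcntF
    rw [this]
    exact integrable_finsetSum _ fun i _ => (integrable_const 1).indicator (hFmeas i)
  have hint_cnt_eq : ∫ x, cnt x ∂μ = ∑ i ∈ Finset.range (k + 1), μ.real (F i) := by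
    rw [integral_congr_ae (Eventually.of_forall hcntF),
      integral_finsetSum _ fun i _ => (integrable_const 1).indicator (hFmeas i)]
    exact Finset.sum_congr rfl fun i _ => by
      rw [integral_indicator_const _ (hFmeas i), smul_eq_mul, mul_one]
  have hmax : Integrable (fun x => max (l x) (-(t : ℝ))) μ := hl.sup (integrable_const _)
  have hcnt_le : -(t : ℝ) + e * ∫ x, cnt x ∂μ ≤ ∫ x, max (l x) (-t) ∂μ + e := by
    have h1 : ∫ x, (-(t : ℝ) + e * cnt x) ∂μ ≤ ∫ x, (max (l x) (-t) + e) ∂μ := by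
      refine integral_mono_ae ((integrable_const _).add (hint_cnt.const_mul e))
        (hmax.add (integrable_const _)) ?_
      filter_upwards [hWM, hWl] with x hx hxl
      have h2 := (log_max_le_count hτ0 hs0 (hx.trans hkR)).2
      have h3 : Real.log (max (opNorm (iter T W.fn N x)) τ) ≤ N * max (l x) (-t) := by
        rw [Real.log_le_iff_le_exp (lt_max_of_lt_right hτ0)]
        refine max_le (hxl.trans (Real.exp_le_exp.2 ?_)) (Real.exp_le_exp.2 ?_)
        · exact mul_le_mul_of_nonneg_left (le_max_left _ _) hN0.le
        · have := mul_le_mul_of_nonneg_left (le_max_right (l x) (-(t : ℝ))) hN0.le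
          linarith
      rw [hlogτ] at h2
      have h4 : N * (-(t : ℝ) + e * cnt x) ≤ N * (max (l x) (-t) + e) := by
        simp only [hcnt]
        rw [hs] at h2
        linarith
      exact le_of_mul_le_mul_left h4 hN0
    rw [integral_add (integrable_const _) (hint_cnt.const_mul e), integral_const_mul,
      integral_add hmax (integrable_const _)] at h1
    simpa using h1
  have hξsum : ∑ i ∈ Finset.range (k + 1), ∫ x, ξ i x ∂μ ≤ ∫ x, cnt x ∂μ + 1 := by
    rw [hint_cnt_eq]
    refine (Finset.sum_le_sum fun i _ => hξint i).trans ?_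
    rw [Finset.sum_add_distrib, Finset.sum_const, Finset.card_range, nsmul_eq_mul, hkr]
  -- uniform domination of the `N`-step norms
  set R := Real.exp M with hR
  have hR1 : 1 ≤ R := Real.one_le_exp hM
  have hRN : 0 < R ^ N := by positivity
  obtain ⟨n₂, hn₂⟩ := exists_nat_ge (2 * N * (M + t) / e)
  refine ⟨min 1 (τ * e / R ^ N), by positivity, max (max N n₁) n₂, f, hf, fun V hV n hn => ?_⟩
  have hV1 : dist V W < 1 := hV.trans_le (min_le_left _ _)
  have hV2 : R ^ N * dist V W ≤ τ * e := by
    have := hV.trans_le (min_le_right _ _)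
    rw [lt_div_iff₀ hRN] at this
    linarith
  have hnN : N ≤ n := (le_max_left _ _).trans ((le_max_left _ _).trans hn)
  have hnn1 : n₁ ≤ n := (le_max_right _ _).trans ((le_max_left _ _).trans hn)
  have hnn2 : (n₂ : ℝ) ≤ n := by exact_mod_cast (le_max_right _ _).trans hn
  have hn0 : (0 : ℝ) < n := by exact_mod_cast hN.trans hnN
  refine le_trans (measure_mono_ae ?_) (hdev n hnn1)
  have hVN : ∀ᵐ x ∂μ, opNorm (iter T V.fn N x) ≤ Real.exp (N * G x) := by
    filter_upwards [ae_orbit hT (hbd V hV1), ae_orbit hT (hbd W (by simp)),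
      ae_orbit hT (ae_opNorm_sub_le V W), hWM] with x h1 h2 h3 h4
    set y := opNorm (iter T W.fn N x) with hy
    have h5 := opNorm_iter_sub_le hR1 dist_nonneg h2 h1 h3 N
    have h6 : opNorm (iter T V.fn N x) ≤ max y τ * Real.exp s := by
      have h7 := opNorm_le_add_sub (iter T V.fn N x) (iter T W.fn N x)
      have h8 : (N : ℝ) * R ^ N * dist V W ≤ max y τ * s := by
        calc (N : ℝ) * R ^ N * dist V W = N * (R ^ N * dist V W) := by ring
          _ ≤ N * (τ * e) := by gcongr
          _ = τ * s := by rw [hs]; ring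
          _ ≤ max y τ * s := by gcongr; exact le_max_right _ _
      have h9 := Real.add_one_le_exp s
      have h10 : y ≤ max y τ := le_max_left _ _
      have h11 : 0 < max y τ := lt_max_of_lt_right hτ0
      nlinarith
    refine h6.trans ?_
    rw [← Real.exp_log (lt_max_of_lt_right hτ0 : 0 < max y τ), ← Real.exp_add]
    refine Real.exp_le_exp.2 ?_
    have h7 := (log_max_le_count hτ0 hs0 (h4.trans hkR)).1
    have h8 : s * cnt x ≤ s * ∑ i ∈ Finset.range (k + 1), ξ i x :=
      mul_le_mul_of_nonneg_left (hcntξ x) hs0.le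
    rw [hlogτ] at h7
    have h9 : N * G x = -(t * N) + s * ∑ i ∈ Finset.range (k + 1), ξ i x + s := by
      simp only [hG, ha, hs]; ring
    rw [h9]
    simp only [hcnt] at h8
    linarith
  filter_upwards [ae_orbit hT (hbd V hV1), ae_orbit hT hVN] with x h1 h2 hx
  by_contra hcon
  have hcon' : ∀ i < k + 1,
      |(1 / (n : ℝ)) * ∑ j ∈ Finset.range n, ξ i (T^[j] x) - ∫ y, ξ i y ∂μ| ≤ r := by
    intro i hi
    by_contra h
    exact hcon ⟨i, hi, not_le.1 h⟩
  have h3 := opNorm_iter_le_exp_sum hN hM h1 h2 (Nat.cast_nonneg t) hGt hnN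
  refine absurd hx (not_lt.2 (h3.trans (Real.exp_le_exp.2 ?_)))
  have h4 : ∑ j ∈ Finset.range n, G (T^[j] x) =
      n * a + e * ∑ i ∈ Finset.range (k + 1), ∑ j ∈ Finset.range n, ξ i (T^[j] x) := by
    simp only [hG, Finset.sum_add_distrib, ← Finset.mul_sum]
    rw [Finset.sum_comm]
    simp
  have h5 : ∑ i ∈ Finset.range (k + 1), ∑ j ∈ Finset.range n, ξ i (T^[j] x) ≤
      n * (∫ x, cnt x ∂μ + 2) := by
    have h6 : ∀ i ∈ Finset.range (k + 1), ∑ j ∈ Finset.range n, ξ i (T^[j] x) ≤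
        n * (∫ y, ξ i y ∂μ + r) := by
      intro i hi
      have h7 := (abs_le.1 (hcon' i (Finset.mem_range.1 hi))).2
      have h8 : (1 / (n : ℝ)) * ∑ j ∈ Finset.range n, ξ i (T^[j] x) ≤ ∫ y, ξ i y ∂μ + r := by
        linarith
      rw [one_div, ← div_eq_inv_mul, div_le_iff₀ hn0] at h8
      linarith
    refine (Finset.sum_le_sum h6).trans ?_
    rw [← Finset.mul_sum, Finset.sum_add_distrib, Finset.sum_const, Finset.card_range,
      nsmul_eq_mul, hkr]
    exact mul_le_mul_of_nonneg_left (by linarith) hn0.le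
  have h6 : 2 * N * (M + t) ≤ n * e := by
    rw [div_le_iff₀ he] at hn₂
    nlinarith
  have h7 := mul_le_mul_of_nonneg_left h5 he.le
  have h8 : (n : ℝ) * (e * ∫ x, cnt x ∂μ) ≤ n * (c - 4 * e + t) :=
    mul_le_mul_of_nonneg_left (by linarith) hn0.le
  rw [h4, ha]
  linarith

end UpperDeviations

/-! ### Finite scale exponents under a uniform second moment bound -/

section FiniteScale

variable {X : Type*} {m : ℕ} {T : X → X} {A : X → Matrix (Fin m) (Fin m) ℝ}

/-- The real function `(1/n) log ‖A^{(n)}(x)‖`; it has the junk value `0` where `A^{(n)}(x) = 0`,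
which is a null set under the moment bounds below. -/
noncomputable def logNorm (T : X → X) (A : X → Matrix (Fin m) (Fin m) ℝ) (n : ℕ) (x : X) : ℝ :=
  1 / (n : ℝ) * Real.log (opNorm (iter T A n x))

lemma mul_logNorm {n : ℕ} (hn : 1 ≤ n) (x : X) :
    n * logNorm T A n x = Real.log (opNorm (iter T A n x)) := by
  have : (n : ℝ) ≠ 0 := by positivity
  rw [logNorm]; field_simp

variable [MeasurableSpace X] {μ : Measure X}

/-- The integral of `logNorm`, a real version of `finiteLE`. -/
noncomputable def meanLog (μ : Measure X) (T : X → X) (A : X → Matrix (Fin m) (Fin m) ℝ) (n : ℕ) :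
    ℝ :=
  ∫ x, logNorm T A n x ∂μ

/-- The second moments of `(1/n) log ‖A^{(n)}‖`, `n ≥ 1`, are bounded by `K²`. -/
def LogBound (μ : Measure X) (T : X → X) (A : X → Matrix (Fin m) (Fin m) ℝ) (K : ℝ≥0) : Prop :=
  ∀ n : ℕ, 1 ≤ n → eLpNorm (fun x => (scaledLog n (opNorm (iter T A n x))).abs) 2 μ < K

lemma measurable_logNorm (hT : Measurable T) (hA : ∀ i j, Measurable fun x => A x i j) (n : ℕ) :
    Measurable (logNorm T A n) :=
  (Real.measurable_log.comp (measurable_opNorm_iter hT hA n)).const_mul _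

namespace LogBound

variable {K : ℝ≥0}

lemma ae_pos (h : LogBound μ T A K) (hT : Measurable T) (hA : ∀ i j, Measurable fun x => A x i j)
    {n : ℕ} (hn : 1 ≤ n) : ∀ᵐ x ∂μ, 0 < opNorm (iter T A n x) := by
  set Z := {x | opNorm (iter T A n x) ≤ 0} with hZ
  have hZm : MeasurableSet Z :=
    measurableSet_le (measurable_opNorm_iter hT hA n) measurable_const
  have h1 := (h n hn).trans_le le_top
  have h2 : μ Z = 0 := by
    by_contra hne
    have h3 : eLpNorm (Z.indicator fun _ => (⊤ : ℝ≥0∞)) 2 μ ≤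
        eLpNorm (fun x => (scaledLog n (opNorm (iter T A n x))).abs) 2 μ := by
      refine eLpNorm_mono_enorm fun x => ?_
      by_cases hx : x ∈ Z
      · rw [Set.indicator_of_mem hx, scaledLog_of_nonpos hn hx, EReal.abs_bot]
      · rw [Set.indicator_of_notMem hx]; simp
    rw [eLpNorm_indicator_const' hZm hne (by norm_num)] at h3
    have h4 : (⊤ : ℝ≥0∞) * μ Z ^ (1 / (2 : ℝ≥0∞).toReal) = ⊤ := by
      refine ENNReal.top_mul ?_
      simp [hne]
    rw [enorm_eq_self, h4] at h3
    exact absurd h1 (not_lt.2 h3)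
  rw [ae_iff]
  simpa [hZ, not_lt] using h2

lemma ae_scaledLog (h : LogBound μ T A K) (hT : Measurable T)
    (hA : ∀ i j, Measurable fun x => A x i j) {n : ℕ} (hn : 1 ≤ n) :
    ∀ᵐ x ∂μ, scaledLog n (opNorm (iter T A n x)) = (logNorm T A n x : EReal) := by
  filter_upwards [h.ae_pos hT hA hn] with x hx
  exact scaledLog_of_pos n hx

lemma eLpNorm_lt (h : LogBound μ T A K) (hT : Measurable T)
    (hA : ∀ i j, Measurable fun x => A x i j) {n : ℕ} (hn : 1 ≤ n) :
    eLpNorm (logNorm T A n) 2 μ < K := by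
  refine lt_of_eq_of_lt ?_ (h n hn)
  rw [← eLpNorm_enorm]
  refine eLpNorm_congr_ae ?_
  filter_upwards [h.ae_scaledLog hT hA hn] with x hx
  rw [hx, EReal.abs_def, Real.enorm_eq_ofReal_abs]

lemma memLp (h : LogBound μ T A K) (hT : Measurable T) (hA : ∀ i j, Measurable fun x => A x i j)
    {n : ℕ} (hn : 1 ≤ n) : MemLp (logNorm T A n) 2 μ :=
  ⟨(measurable_logNorm hT hA n).aestronglyMeasurable, (h.eLpNorm_lt hT hA hn).trans_le le_top⟩

/-- Cauchy-Schwarz on a small set. -/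
lemma setIntegral_abs_le [IsProbabilityMeasure μ] (h : LogBound μ T A K) (hT : Measurable T)
    (hA : ∀ i j, Measurable fun x => A x i j) {n : ℕ} (hn : 1 ≤ n) (S : Set X) :
    ∫ x in S, |logNorm T A n x| ∂μ ≤ K * √(μ.real S) := by
  have hmeas := (measurable_logNorm (T := T) hT hA n)
  have h1 : eLpNorm (logNorm T A n) 1 (μ.restrict S) ≤ K * μ S ^ (1 / 2 : ℝ) := by
    have h2 := eLpNorm_le_eLpNorm_mul_rpow_measure_univ (μ := μ.restrict S) (p := 1) (q := 2)
      (by norm_num) hmeas.aestronglyMeasurable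
    rw [Measure.restrict_apply_univ] at h2
    refine h2.trans ?_
    have h3 : (1 / (1 : ℝ≥0∞).toReal - 1 / (2 : ℝ≥0∞).toReal) = (1 / 2 : ℝ) := by norm_num
    rw [h3]
    gcongr
    exact (eLpNorm_restrict_le _ _ _ _).trans (h.eLpNorm_lt hT hA hn).le
  have h4 : ∫ x in S, |logNorm T A n x| ∂μ = (eLpNorm (logNorm T A n) 1 (μ.restrict S)).toReal := by
    rw [eLpNorm_one_eq_lintegral_enorm, ← integral_norm_eq_lintegral_enorm
      hmeas.aestronglyMeasurable]
    rfl
  rw [h4]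
  have h5 := ENNReal.toReal_mono (b := K * μ S ^ (1 / 2 : ℝ))
    (ENNReal.mul_ne_top ENNReal.coe_ne_top
      (ENNReal.rpow_ne_top_of_nonneg (by norm_num) (measure_ne_top _ _))) h1
  rwa [ENNReal.toReal_mul, ENNReal.coe_toReal, ← ENNReal.toReal_rpow, ← Real.sqrt_eq_rpow] at h5

lemma integrable [IsProbabilityMeasure μ] (h : LogBound μ T A K) (hT : Measurable T)
    (hA : ∀ i j, Measurable fun x => A x i j) {n : ℕ} (hn : 1 ≤ n) :
    Integrable (logNorm T A n) μ :=
  (h.memLp hT hA hn).integrable (by norm_num)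

lemma integral_abs_le [IsProbabilityMeasure μ] (h : LogBound μ T A K) (hT : Measurable T)
    (hA : ∀ i j, Measurable fun x => A x i j) {n : ℕ} (hn : 1 ≤ n) :
    ∫ x, |logNorm T A n x| ∂μ ≤ K := by
  simpa using h.setIntegral_abs_le hT hA hn Set.univ

lemma abs_meanLog_le [IsProbabilityMeasure μ] (h : LogBound μ T A K) (hT : Measurable T)
    (hA : ∀ i j, Measurable fun x => A x i j) {n : ℕ} (hn : 1 ≤ n) : |meanLog μ T A n| ≤ K :=
  (abs_integral_le_integral_abs).trans (h.integral_abs_le hT hA hn)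

lemma finiteLE_eq [IsProbabilityMeasure μ] (h : LogBound μ T A K) (hT : Measurable T)
    (hA : ∀ i j, Measurable fun x => A x i j) {n : ℕ} (hn : 1 ≤ n) :
    finiteLE μ T A n = (meanLog μ T A n : EReal) :=
  expect_eq_integral (h.integrable hT hA hn) (h.ae_scaledLog hT hA hn)

lemma subadditive [IsProbabilityMeasure μ] (h : LogBound μ T A K) (hT : MeasurePreserving T μ μ)
    (hA : ∀ i j, Measurable fun x => A x i j) :
    Subadditive fun n : ℕ => n * meanLog μ T A n := by
  intro p q
  rcases Nat.eq_zero_or_pos p with rfl | hp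
  · simp
  rcases Nat.eq_zero_or_pos q with rfl | hq
  · simp
  have hpq : 1 ≤ p + q := by omega
  have hq' := (hT.iterate q)
  have hint : ∀ {k : ℕ}, 1 ≤ k → Integrable (fun x => (k : ℝ) * logNorm T A k x) μ :=
    fun hk => (h.integrable hT.measurable hA hk).const_mul _
  have hshift : ∫ x, (p : ℝ) * logNorm T A p (T^[q] x) ∂μ = p * meanLog μ T A p := by
    rw [integral_const_mul]
    congr 1
    have := integral_map (μ := μ) hq'.measurable.aemeasurable (f := logNorm T A p)
      (measurable_logNorm hT.measurable hA p).aestronglyMeasurable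
    rw [hq'.map_eq] at this
    exact this.symm
  have hints : Integrable (fun x => (p : ℝ) * logNorm T A p (T^[q] x)) μ :=
    (hq'.integrable_comp_of_integrable (hint hp))
  have h1 : ∫ x, ((p + q : ℕ) : ℝ) * logNorm T A (p + q) x ∂μ ≤
      ∫ x, ((p : ℝ) * logNorm T A p (T^[q] x) + q * logNorm T A q x) ∂μ := by
    refine integral_mono_ae (hint hpq) (hints.add (hint hq)) ?_
    filter_upwards [h.ae_pos hT.measurable hA hpq, h.ae_pos hT.measurable hA hq,
      hq'.quasiMeasurePreserving.ae (h.ae_pos hT.measurable hA hp)] with x h1 h2 h3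
    rw [mul_logNorm hpq, mul_logNorm hp, mul_logNorm hq, ← Real.log_mul h3.ne' h2.ne']
    rw [iter_add] at h1 ⊢
    exact Real.log_le_log h1 (opNorm_mul_le _ _)
  rw [integral_add hints (hint hq), hshift, integral_const_mul, integral_const_mul] at h1
  exact h1

lemma exists_limit [IsProbabilityMeasure μ] (h : LogBound μ T A K) (hT : MeasurePreserving T μ μ)
    (hA : ∀ i j, Measurable fun x => A x i j) (hm : 0 < m) :
    ∃ L : ℝ, lyapunov μ T A 1 = L ∧ Tendsto (meanLog μ T A) atTop (𝓝 L) ∧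
      ∀ n, 1 ≤ n → L ≤ meanLog μ T A n := by
  have hsub := h.subadditive hT hA
  have hdiv : ∀ n : ℕ, 1 ≤ n → (n * meanLog μ T A n) / n = meanLog μ T A n := by
    intro n hn
    have : (n : ℝ) ≠ 0 := by positivity
    field_simp
  have hbdd : BddBelow (Set.range fun n : ℕ => (n * meanLog μ T A n) / (n : ℝ)) := by
    refine ⟨-K, ?_⟩
    rintro _ ⟨n, rfl⟩
    rcases Nat.eq_zero_or_pos n with rfl | hn
    · simp
    · dsimp only
      rw [hdiv n hn]
      exact (abs_le.1 (h.abs_meanLog_le hT.measurable hA hn)).1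
  have hlim : Tendsto (meanLog μ T A) atTop (𝓝 hsub.lim) := by
    refine (hsub.tendsto_lim hbdd).congr' ?_
    filter_upwards [eventually_ge_atTop 1] with n hn using hdiv n hn
  refine ⟨hsub.lim, ?_, hlim, fun n hn => ?_⟩
  · have h1 : Tendsto (fun n => (meanLog μ T A n : EReal)) atTop (𝓝 (hsub.lim : EReal)) :=
      (continuous_coe_real_ereal.tendsto _).comp hlim
    have h2 : (fun n : ℕ => expect μ (fun x => scaledLog n (singularValue 1 (iter T A n x))))
        =ᶠ[atTop] fun n => (meanLog μ T A n : EReal) := by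
      filter_upwards [eventually_ge_atTop 1] with n hn
      rw [← h.finiteLE_eq hT.measurable hA hn, finiteLE]
      simp only [opNorm_eq_singularValue_one hm]
    rw [lyapunov, limsup_congr h2]
    exact h1.limsup_eq
  · have := hsub.lim_le_div hbdd (n := n) (by omega)
    rwa [hdiv n hn] at this

/-- If, off a set of measure `ι`, the function `(1/n) log ‖A^{(n)}‖` deviates by at most `e` from its
mean, then its integral over a set `S`, also after a time shift, is small with `μ(S)` to first
order: the second moment is only used on the deviation set. -/
lemma setIntegral_shift_le [IsProbabilityMeasure μ] (h : LogBound μ T A K)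
    (hT : MeasurePreserving T μ μ) (hA : ∀ i j, Measurable fun x => A x i j) {n : ℕ} (hn : 1 ≤ n)
    {e ι : ℝ} (he : 0 ≤ e) (hι : 0 ≤ ι)
    (hdev : μ {x | e < |logNorm T A n x - meanLog μ T A n|} ≤ ENNReal.ofReal ι)
    {S : Set X} (hS : MeasurableSet S) (j : ℕ) :
    ∫ x in S, |logNorm T A n (T^[j] x)| ∂μ ≤ (K + e) * μ.real S + K * √ι := by
  have hTj := hT.iterate j
  have hm := measurable_logNorm hT.measurable hA n
  set D := {x | e < |logNorm T A n x - meanLog μ T A n|} with hD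
  have hDm : MeasurableSet D :=
    measurableSet_lt measurable_const (hm.sub_const _).abs
  set D' := T^[j] ⁻¹' D with hD'
  have hDm' : MeasurableSet D' := hTj.measurable hDm
  have hint : Integrable (fun x => |logNorm T A n (T^[j] x)|) μ :=
    hTj.integrable_comp_of_integrable (h.integrable hT.measurable hA hn).abs
  have h1 : ∫ x in S, |logNorm T A n (T^[j] x)| ∂μ ≤
      ∫ x, (S.indicator (fun _ => (K : ℝ) + e) x +
        D'.indicator (fun x => |logNorm T A n (T^[j] x)|) x) ∂μ := by
    rw [← integral_indicator hS]
    refine integral_mono (hint.indicator hS)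
      (((integrable_const _).indicator hS).add (hint.indicator hDm')) fun x => ?_
    by_cases hx : x ∈ S
    · by_cases hx' : x ∈ D'
      · simp only [Set.indicator_of_mem hx, Set.indicator_of_mem hx']
        have : (0 : ℝ) ≤ K := K.2
        linarith
      · simp only [Set.indicator_of_mem hx, Set.indicator_of_notMem hx', add_zero]
        have h2 : |logNorm T A n (T^[j] x) - meanLog μ T A n| ≤ e := not_lt.1 hx'
        have h3 := h.abs_meanLog_le hT.measurable hA hn
        have h4 := abs_sub_abs_le_abs_sub (logNorm T A n (T^[j] x)) (meanLog μ T A n)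
        linarith
    · simp only [Set.indicator_of_notMem hx, zero_add]
      exact Set.indicator_nonneg (fun _ _ => abs_nonneg _) x
  rw [integral_add ((integrable_const _).indicator hS) (hint.indicator hDm'),
    integral_indicator_const _ hS, smul_eq_mul, mul_comm, integral_indicator hDm'] at h1
  refine h1.trans (add_le_add le_rfl ?_)
  have h5 : ∫ x in D', |logNorm T A n (T^[j] x)| ∂μ = ∫ x in D, |logNorm T A n x| ∂μ := by
    have := setIntegral_map (μ := μ) hDm (f := fun x => |logNorm T A n x|)
      (hm.abs.aestronglyMeasurable) hTj.measurable.aemeasurable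
    rw [hTj.map_eq] at this
    exact this.symm
  rw [h5]
  refine (h.setIntegral_abs_le hT.measurable hA hn D).trans
    (mul_le_mul_of_nonneg_left (Real.sqrt_le_sqrt ?_) K.2)
  exact ENNReal.toReal_le_of_le_ofReal hι hdev

end LogBound

/-- The product of the first two singular values decays at a scale `N` with an exponent below
`L₁ + L₂ + ε`, or arbitrarily fast if `L₂ = -∞`. -/
lemma exists_wedge_majorant [IsProbabilityMeasure μ] {K : ℝ≥0} (h : LogBound μ T A K)
    (hT : MeasurePreserving T μ μ) (hA : ∀ i j, Measurable fun x => A x i j) (hm : 2 ≤ m)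
    {M : ℝ} (hbd : ∀ᵐ x ∂μ, opNorm (A x) ≤ Real.exp M)
    (hwm : ∀ n, Measurable fun x => opNorm (wedge 2 (iter T A n x))) {L κ : ℝ}
    (hL : Tendsto (meanLog μ T A) atTop (𝓝 L)) (hL1 : lyapunov μ T A 1 = L)
    (hκ : IsGap μ T A κ) {ε : ℝ} (hε : 0 < ε) :
    ∃ N : ℕ, 1 ≤ N ∧ ∃ l : X → ℝ, Integrable l μ ∧
      (∀ᵐ x ∂μ, opNorm (iter T (fun x => wedge 2 (A x)) N x) ≤ Real.exp (N * l x)) ∧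
      ∫ x, l x ∂μ < 2 * L - κ + ε := by
  have hlt : lyapunov μ T A 2 < ((L - κ + ε / 4 : ℝ) : EReal) := by
    by_cases hbot : lyapunov μ T A 2 = ⊥
    · rw [hbot]; exact EReal.bot_lt_coe _
    · have h1 := hκ.2.2 hbot
      have h2 := hκ.1
      rw [hL1] at h1 h2
      generalize lyapunov μ T A 2 = z at h1 h2 hbot
      induction z with
      | bot => exact absurd rfl hbot
      | top => exact absurd h2 (not_lt.2 le_top)
      | coe z =>
        rw [← EReal.coe_sub, EReal.coe_eq_coe_iff] at h1
        rw [EReal.coe_lt_coe_iff]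
        linarith
  set Cst : ℝ := ((m.choose 2 : ℕ) : ℝ) ^ 2 * 6 with hCst
  have hC0 : 0 < Cst := by
    have : 0 < m.choose 2 := Nat.choose_pos hm
    positivity
  have hev1 := eventually_lt_of_limsup_lt hlt
  have hev2 : ∀ᶠ n in atTop, meanLog μ T A n < L + ε / 4 := hL.eventually (gt_mem_nhds (by linarith))
  have hev3 : ∀ᶠ n : ℕ in atTop, 1 / (n : ℝ) * Real.log Cst < ε / 4 := by
    have : Tendsto (fun n : ℕ => 1 / (n : ℝ) * Real.log Cst) atTop (𝓝 (0 * Real.log Cst)) :=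
      tendsto_one_div_atTop_nhds_zero_nat.mul_const _
    rw [zero_mul] at this
    exact this.eventually (gt_mem_nhds (by positivity))
  obtain ⟨N, ⟨⟨h1, h2⟩, h3⟩, hN⟩ :=
    (((hev1.and hev2).and hev3).and (eventually_ge_atTop 1)).exists
  have hN0 : (0 : ℝ) < N := by exact_mod_cast hN
  -- a measurable function that is comparable with the second singular value
  set f : X → ℝ := fun x =>
    opNorm (wedge 2 (iter T A N x)) / (Cst * opNorm (iter T A N x)) with hf
  have hfm : Measurable f :=
    (hwm N).div ((measurable_opNorm_iter hT.measurable hA N).const_mul _)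
  have hfs : ∀ x, f x ≤ singularValue 2 (iter T A N x) := by
    intro x
    have hs := (Matrix.toEuclideanLin (iter T A N x)).singularValues_nonneg 1
    have h0 := opNorm_nonneg (iter T A N x)
    refine div_le_of_le_mul₀ (by positivity) hs ?_
    have := opNorm_wedge_two_le hm (iter T A N x)
    rw [hCst]
    linarith
  have hfR : ∀ᵐ x ∂μ, f x ≤ Real.exp M ^ N := by
    filter_upwards [ae_orbit hT hbd] with x hx
    refine (hfs x).trans (le_trans ?_ (opNorm_iter_le (Real.exp_pos _).le hx N))
    rw [opNorm_eq_singularValue_one (by omega)]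
    exact (Matrix.toEuclideanLin (iter T A N x)).singularValues_antitone zero_le_one
  obtain ⟨l, hl, hfl, hlc⟩ := exists_integrable_majorant hN hfm hfR
    ((expect_mono fun x => scaledLog_mono N (hfs x)).trans_lt h1)
  have hi := h.integrable hT.measurable hA hN
  refine ⟨N, hN, fun x => logNorm T A N x + l x + 1 / (N : ℝ) * Real.log Cst,
    (hi.add hl).add (integrable_const _), ?_, ?_⟩
  · filter_upwards [h.ae_pos hT.measurable hA hN] with x hx
    rw [iter_wedge]
    have e1 : opNorm (wedge 2 (iter T A N x)) = f x * Cst * opNorm (iter T A N x) := by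
      simp only [hf]; field_simp
    have e2 : N * (logNorm T A N x + l x + 1 / (N : ℝ) * Real.log Cst) =
        N * l x + Real.log Cst + N * logNorm T A N x := by field_simp; ring
    rw [e1, e2, Real.exp_add, Real.exp_add, Real.exp_log hC0, mul_logNorm hN, Real.exp_log hx]
    gcongr
    exact hfl x
  · have hadd : Integrable (fun x => logNorm T A N x + l x) μ := hi.add hl
    have e3 : ∫ x, (logNorm T A N x + l x + 1 / (N : ℝ) * Real.log Cst) ∂μ =
        meanLog μ T A N + ∫ x, l x ∂μ + 1 / (N : ℝ) * Real.log Cst := by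
      rw [integral_add hadd (integrable_const _), integral_add hi hl, integral_const,
        probReal_univ, one_smul]
      rfl
    linarith

end FiniteScale

/-! ### Passing from one scale to a much larger one -/

section Induction

variable {X : Type*} {m : ℕ} {T : X → X} {A : X → Matrix (Fin m) (Fin m) ℝ}

/-- The deviation from additivity, over `p + 1` blocks of length `n`, that the avalanche principle
controls; each logarithm of a norm is written as a multiple of `logNorm`. -/
noncomputable def avalancheDefect (T : X → X) (A : X → Matrix (Fin m) (Fin m) ℝ) (n p : ℕ) (x : X) :
    ℝ :=
  ((p + 1) * n : ℕ) * logNorm T A ((p + 1) * n) x - n * logNorm T A n x -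
    ∑ i ∈ Finset.range p, ((2 * n : ℕ) * logNorm T A (2 * n) (T^[i * n] x) -
      n * logNorm T A n (T^[i * n] x))

/-- The avalanche principle along an orbit: `a`, `b` play the role of the mean exponents at the
scales `n` and `2n`, and `c` bounds the exponent of `∧₂ A` at the scale `n`. -/
lemma abs_avalancheDefect_le (hm : 2 ≤ m) {n : ℕ} (hn : 1 ≤ n) (p : ℕ) {x : X} {a b c e κ ε : ℝ}
    (hκ : κ = (m : ℝ) ^ 3 * Real.exp (n * (c - 2 * (a - e))))
    (hε : ε = Real.exp (2 * n * (b - a - 2 * e))) (hκε : κ ≤ ε ^ 2 / 100)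
    (hpos1 : ∀ i ≤ p, 0 < opNorm (iter T A n (T^[i * n] x)))
    (hpos2 : ∀ i < p, 0 < opNorm (iter T A (2 * n) (T^[i * n] x)))
    (h1 : ∀ i ≤ p, |logNorm T A n (T^[i * n] x) - a| ≤ e)
    (h2 : ∀ i < p, |logNorm T A (2 * n) (T^[i * n] x) - b| ≤ e)
    (h3 : ∀ i ≤ p, opNorm (wedge 2 (iter T A n (T^[i * n] x))) ≤ Real.exp (n * c)) :
    |avalancheDefect T A n p x| ≤ 16 * p * (κ / ε ^ 2) := by
  have hn0 : (0 : ℝ) < n := by exact_mod_cast hn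
  have hn2 : 1 ≤ 2 * n := by omega
  set g : ℕ → EuclideanSpace ℝ (Fin m) →L[ℝ] EuclideanSpace ℝ (Fin m) :=
    fun i => toOp (iter T A n (T^[i * n] x)) with hg
  set h : ℕ → EuclideanSpace ℝ (Fin m) →L[ℝ] EuclideanSpace ℝ (Fin m) :=
    fun i => toOp (iter T A ((i + 1) * n) x) with hh
  have hgn : ∀ i, ‖g i‖ = opNorm (iter T A n (T^[i * n] x)) := fun i => rfl
  have hgg : ∀ i, g (i + 1) * g i = toOp (iter T A (2 * n) (T^[i * n] x)) := by
    intro i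
    have : T^[(i + 1) * n] x = T^[n] (T^[i * n] x) := by
      rw [← Function.iterate_add_apply]; congr 2; ring
    simp only [hg]
    rw [← toOp_mul, two_mul, iter_add, this]
  have hlog1 : ∀ i, Real.log ‖g i‖ = n * logNorm T A n (T^[i * n] x) :=
    fun i => (mul_logNorm hn _).symm
  have hlog2 : ∀ i, Real.log ‖g (i + 1) * g i‖ =
      (2 * n : ℕ) * logNorm T A (2 * n) (T^[i * n] x) := fun i => by
    rw [hgg]; exact (mul_logNorm hn2 _).symm
  have hnorm1 : ∀ i ≤ p, ‖g i‖ = Real.exp (n * logNorm T A n (T^[i * n] x)) := fun i hi => by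
    rw [← hlog1, Real.exp_log (by rw [hgn]; exact hpos1 i hi)]
  have hnorm2 : ∀ i < p, ‖g (i + 1) * g i‖ =
      Real.exp ((2 * n : ℕ) * logNorm T A (2 * n) (T^[i * n] x)) := fun i hi => by
    rw [← hlog2, Real.exp_log (by rw [hgg]; exact hpos2 i hi)]
  have hAP := avalanche_principle (g := g) (h := h) (κ := κ) (ε := ε)
    (by rw [hε]; exact Real.exp_pos _) (by rw [hκ]; positivity) hκε p (by simp [hg, hh])
    (fun i => by
      simp only [hg, hh]
      rw [← toOp_mul, ← iter_add]
      congr 2; ring)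
    (fun i hi => hpos1 i hi)
    (fun i hi => by
      obtain ⟨φ, u, hφ, hu, hr⟩ := exists_near_rank_one hm _ (hpos1 i hi)
      refine ⟨φ, u, hφ, hu, ?_⟩
      have hp := hpos1 i hi
      refine le_of_mul_le_mul_right (le_trans hr ?_) hp
      refine (mul_le_mul_of_nonneg_left (h3 i hi) (by positivity)).trans ?_
      rw [← hgn, hnorm1 i hi, hκ, mul_assoc, mul_assoc, ← Real.exp_add, ← Real.exp_add]
      refine mul_le_mul_of_nonneg_left (Real.exp_le_exp.2 ?_) (by positivity)
      have := (abs_le.1 (h1 i hi)).1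
      nlinarith)
    (fun i hi => by
      rw [hnorm1 i hi.le, hnorm1 (i + 1) hi, hnorm2 i hi, hε, ← Real.exp_add, ← Real.exp_add]
      refine Real.exp_le_exp.2 ?_
      have e1 := (abs_le.1 (h1 i hi.le)).2
      have e2 := (abs_le.1 (h1 (i + 1) hi)).2
      have e3 := (abs_le.1 (h2 i hi)).1
      push_cast
      nlinarith)
  have hfin : avalancheDefect T A n p x = Real.log ‖h p‖ - Real.log ‖g 0‖ -
      ∑ i ∈ Finset.range p, (Real.log ‖g (i + 1) * g i‖ - Real.log ‖g i‖) := by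
    simp only [hlog1, hlog2]
    rw [avalancheDefect, mul_logNorm (n := (p + 1) * n) (Nat.mul_pos (Nat.succ_pos p) hn)]
    simp [hh, opNorm]
  rw [hfin]
  exact hAP

variable [MeasurableSpace X] {μ : Measure X}

/-- The mean exponent at a multiple of the scale `n` is, up to an error inversely proportional to the
number `p + 1` of blocks, determined by those at the scales `n` and `2n`. The hypothesis
`(p + 1) √ι ≤ 1` makes the exceptional set, of measure at most `3 (p + 1) ι`, negligible. -/
lemma abs_meanLog_block_le [IsProbabilityMeasure μ] {K : ℝ≥0} (h : LogBound μ T A K)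
    (hT : MeasurePreserving T μ μ) (hA : ∀ i j, Measurable fun x => A x i j) (hm : 2 ≤ m)
    (hwm : ∀ n, Measurable fun x => opNorm (wedge 2 (iter T A n x)))
    {n : ℕ} (hn : 1 ≤ n) (p : ℕ) {c e κ ε ι Q : ℝ} (he : 0 ≤ e) (hι : 0 ≤ ι)
    (hκ : κ = (m : ℝ) ^ 3 * Real.exp (n * (c - 2 * (meanLog μ T A n - e))))
    (hε : ε = Real.exp (2 * n * (meanLog μ T A (2 * n) - meanLog μ T A n - 2 * e)))
    (hκε : κ ≤ ε ^ 2 / 100) (hQ : (p + 1) * (κ / ε ^ 2) ≤ Q) (hpι : (p + 1) * √ι ≤ 1)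
    (hdev : ∀ k, n ≤ k → μ {x | e < |logNorm T A k x - meanLog μ T A k|} ≤ ENNReal.ofReal ι)
    (hwdev : μ {x | Real.exp (n * c) < opNorm (wedge 2 (iter T A n x))} ≤ ENNReal.ofReal ι) :
    |meanLog μ T A ((p + 1) * n) + meanLog μ T A n - 2 * meanLog μ T A (2 * n)|
      ≤ (16 * Q + 20 * K + 12 * e) / (p + 1) := by
  have hn0 : (0 : ℝ) < n := by exact_mod_cast hn
  have hn1 : (1 : ℝ) ≤ n := by exact_mod_cast hn
  have hn2 : 1 ≤ 2 * n := by omega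
  have hpn : 1 ≤ (p + 1) * n := Nat.mul_pos (Nat.succ_pos p) hn
  have hp0 : (0 : ℝ) < p + 1 := by positivity
  have hK : (0 : ℝ) ≤ K := K.2
  have hTm := hT.measurable
  set a := meanLog μ T A n with ha
  set b := meanLog μ T A (2 * n) with hb
  set d := meanLog μ T A ((p + 1) * n) with hd
  -- the exceptional set
  set E : Set X := {x | e < |logNorm T A n x - a|} ∪ ({x | e < |logNorm T A (2 * n) x - b|} ∪
    {x | Real.exp (n * c) < opNorm (wedge 2 (iter T A n x))}) with hE
  have hEm : MeasurableSet E :=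
    (measurableSet_lt measurable_const ((measurable_logNorm hTm hA n).sub_const _).abs).union
      ((measurableSet_lt measurable_const ((measurable_logNorm hTm hA _).sub_const _).abs).union
        (measurableSet_lt measurable_const (hwm n)))
  have hEι : μ.real E ≤ 3 * ι := by
    refine ENNReal.toReal_le_of_le_ofReal (by positivity) ?_
    have : ENNReal.ofReal (3 * ι) =
        ENNReal.ofReal ι + (ENNReal.ofReal ι + ENNReal.ofReal ι) := by
      rw [← ENNReal.ofReal_add hι hι, ← ENNReal.ofReal_add hι (by positivity)]
      congr 1; ring
    rw [this]
    exact (measure_union_le _ _).trans (add_le_add (hdev n le_rfl)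
      ((measure_union_le _ _).trans (add_le_add (hdev _ (by omega)) hwdev)))
  set S : Set X := ⋃ i ∈ Finset.range (p + 1), T^[i * n] ⁻¹' E with hS
  have hSm : MeasurableSet S :=
    Finset.measurableSet_biUnion _ fun i _ => hTm.iterate _ hEm
  have hSι : μ.real S ≤ 3 / (p + 1) := by
    have h1 : μ.real S ≤ ∑ i ∈ Finset.range (p + 1), μ.real (T^[i * n] ⁻¹' E) :=
      measureReal_biUnion_finset_le _ _
    have h2 : ∀ i ∈ Finset.range (p + 1), μ.real (T^[i * n] ⁻¹' E) ≤ 3 * ι := fun i _ => by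
      rw [measureReal_def, (hT.iterate _).measure_preimage hEm.nullMeasurableSet]
      exact hEι
    have h3 := h1.trans (Finset.sum_le_card_nsmul _ _ _ h2)
    rw [Finset.card_range, nsmul_eq_mul] at h3
    push_cast at h3
    rw [le_div_iff₀ hp0]
    have h4 : ((p + 1) * √ι) ^ 2 ≤ 1 := pow_le_one₀ (by positivity) hpι
    rw [mul_pow, Real.sq_sqrt hι] at h4
    nlinarith
  have hsι : √ι ≤ 1 / (p + 1) := by
    rw [le_div_iff₀ hp0]; linarith
  set w : ℝ := (4 * K + 3 * e) / (p + 1) with hw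
  have hw0 : 0 ≤ w := by positivity
  have hpart : ∀ k, n ≤ k → ∀ j, ∫ x in S, |logNorm T A k (T^[j] x)| ∂μ ≤ w := by
    intro k hk j
    refine (h.setIntegral_shift_le hT hA (hn.trans hk) he hι (hdev k hk) hSm j).trans ?_
    calc (K + e) * μ.real S + K * √ι ≤ (K + e) * (3 / (p + 1)) + K * (1 / (p + 1)) := by gcongr
      _ = w := by rw [hw]; field_simp; ring
  -- integrability
  have hint : ∀ k, n ≤ k → ∀ j, Integrable (fun x => logNorm T A k (T^[j] x)) μ := fun k hk j =>
    (hT.iterate j).integrable_comp_of_integrable (h.integrable hTm hA (hn.trans hk))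
  have hmean : ∀ k, n ≤ k → ∀ j, ∫ x, logNorm T A k (T^[j] x) ∂μ = meanLog μ T A k := by
    intro k hk j
    have := integral_map (μ := μ) (hT.iterate j).measurable.aemeasurable (f := logNorm T A k)
      (measurable_logNorm hTm hA k).aestronglyMeasurable
    rw [(hT.iterate j).map_eq] at this
    exact this.symm
  have hpnn : n ≤ (p + 1) * n := Nat.le_mul_of_pos_left n (Nat.succ_pos p)
  have h2nn : n ≤ 2 * n := by omega
  have i1 : Integrable (fun x => ((p + 1) * n : ℕ) * logNorm T A ((p + 1) * n) x) μ :=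
    (hint _ hpnn 0).const_mul _
  have i2 : Integrable (fun x => (n : ℝ) * logNorm T A n x) μ := (hint _ le_rfl 0).const_mul _
  have i3 : ∀ i, Integrable (fun x => (2 * n : ℕ) * logNorm T A (2 * n) (T^[i * n] x) -
      n * logNorm T A n (T^[i * n] x)) μ := fun i =>
    ((hint _ h2nn _).const_mul _).sub ((hint _ le_rfl _).const_mul _)
  have i12 : Integrable (fun x => ((p + 1) * n : ℕ) * logNorm T A ((p + 1) * n) x -
      n * logNorm T A n x) μ := i1.sub i2
  have i4 : Integrable (fun x => ∑ i ∈ Finset.range p,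
      ((2 * n : ℕ) * logNorm T A (2 * n) (T^[i * n] x) - n * logNorm T A n (T^[i * n] x))) μ :=
    integrable_finsetSum _ fun i _ => i3 i
  have hΦint : Integrable (avalancheDefect T A n p) μ := i12.sub i4
  have hΦ : ∫ x, avalancheDefect T A n p x ∂μ =
      ((p + 1) * n : ℝ) * d - n * a - p * (2 * n * b - n * a) := by
    simp only [avalancheDefect]
    rw [integral_sub i12 i4, integral_sub i1 i2, integral_finsetSum _ fun i _ => i3 i,
      integral_const_mul, integral_const_mul]
    have : ∀ i ∈ Finset.range p, ∫ x, ((2 * n : ℕ) * logNorm T A (2 * n) (T^[i * n] x) -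
        n * logNorm T A n (T^[i * n] x)) ∂μ = 2 * n * b - n * a := by
      intro i _
      rw [integral_sub ((hint _ h2nn _).const_mul _) ((hint _ le_rfl _).const_mul _),
        integral_const_mul, integral_const_mul, hmean _ h2nn, hmean _ le_rfl]
      push_cast
      ring
    rw [Finset.sum_congr rfl this, Finset.sum_const, Finset.card_range, nsmul_eq_mul]
    push_cast
    rfl
  -- off the exceptional set, by the avalanche principle
  have hgood : ∀ᵐ x ∂μ, x ∉ S → |avalancheDefect T A n p x| ≤ 16 * Q := by
    filter_upwards [ae_orbit hT (h.ae_pos hTm hA hn), ae_orbit hT (h.ae_pos hTm hA hn2)]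
      with x hx1 hx2 hxS
    have hnot : ∀ i ≤ p, T^[i * n] x ∉ E := fun i hi hmem =>
      hxS (Set.mem_biUnion (Finset.mem_range.2 (Nat.lt_succ_of_le hi)) hmem)
    have hκ0 : 0 ≤ κ / ε ^ 2 := by
      have : 0 ≤ κ := by rw [hκ]; positivity
      positivity
    refine (abs_avalancheDefect_le hm hn p hκ hε hκε (fun i _ => hx1 _) (fun i _ => hx2 _)
      (fun i hi => not_lt.1 fun hlt => hnot i hi (Or.inl hlt))
      (fun i hi => not_lt.1 fun hlt => hnot i hi.le (Or.inr (Or.inl hlt)))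
      (fun i hi => not_lt.1 fun hlt => hnot i hi (Or.inr (Or.inr hlt)))).trans ?_
    linarith
  have hQ0 : 0 ≤ Q := by
    refine le_trans ?_ hQ
    have : 0 ≤ κ := by rw [hκ]; positivity
    positivity
  have hoff : ∫ x in Sᶜ, |avalancheDefect T A n p x| ∂μ ≤ 16 * Q := by
    have h1 : ∫ x in Sᶜ, |avalancheDefect T A n p x| ∂μ ≤ ∫ _ in Sᶜ, 16 * Q ∂μ := by
      refine setIntegral_mono_on_ae hΦint.abs.integrableOn (integrable_const _).integrableOn
        hSm.compl ?_
      filter_upwards [hgood] with x hx hxS using hx hxS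
    rw [setIntegral_const, smul_eq_mul] at h1
    refine h1.trans (mul_le_of_le_one_left (by positivity) measureReal_le_one)
  -- on the exceptional set, by the moment bounds
  have hon : ∫ x in S, |avalancheDefect T A n p x| ∂μ ≤ 4 * (p + 1) * n * w := by
    have hia : ∀ k, n ≤ k → ∀ j, Integrable (fun x => |logNorm T A k (T^[j] x)|) (μ.restrict S) :=
      fun k hk j => (hint k hk j).abs.restrict
    have j1 : Integrable (fun x => ((p + 1) * n : ℝ) * |logNorm T A ((p + 1) * n) x|)
      (μ.restrict S) := (hia _ hpnn 0).const_mul _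
    have j2 : Integrable (fun x => (n : ℝ) * |logNorm T A n x|) (μ.restrict S) :=
      (hia _ le_rfl 0).const_mul _
    have j3 : ∀ i, Integrable (fun x => (2 * n : ℝ) * |logNorm T A (2 * n) (T^[i * n] x)| +
        n * |logNorm T A n (T^[i * n] x)|) (μ.restrict S) := fun i =>
      ((hia _ h2nn _).const_mul _).add ((hia _ le_rfl _).const_mul _)
    have j12 : Integrable (fun x => ((p + 1) * n : ℝ) * |logNorm T A ((p + 1) * n) x| +
      n * |logNorm T A n x|) (μ.restrict S) := j1.add j2
    have j4 : Integrable (fun x => ∑ i ∈ Finset.range p,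
        ((2 * n : ℝ) * |logNorm T A (2 * n) (T^[i * n] x)| + n * |logNorm T A n (T^[i * n] x)|))
        (μ.restrict S) := integrable_finsetSum _ fun i _ => j3 i
    have hpt : ∀ x, |avalancheDefect T A n p x| ≤
        (((p + 1) * n : ℝ) * |logNorm T A ((p + 1) * n) x| + n * |logNorm T A n x|) +
        ∑ i ∈ Finset.range p, ((2 * n : ℝ) * |logNorm T A (2 * n) (T^[i * n] x)| +
          n * |logNorm T A n (T^[i * n] x)|) := by
      intro x
      rw [avalancheDefect]
      have hab : ∀ (r : ℝ) (z : ℝ), 0 ≤ r → |r * z| = r * |z| := fun r z hr => by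
        rw [abs_mul, abs_of_nonneg hr]
      refine (abs_sub _ _).trans (add_le_add ((abs_sub _ _).trans (le_of_eq ?_))
        ((Finset.abs_sum_le_sum_abs _ _).trans (Finset.sum_le_sum fun i _ =>
          (abs_sub _ _).trans (le_of_eq ?_))))
      · rw [hab _ _ (by positivity), hab _ _ (by positivity)]; push_cast; rfl
      · rw [hab _ _ (by positivity), hab _ _ (by positivity)]; push_cast; rfl
    refine (integral_mono hΦint.abs.restrict (j12.add j4) hpt).trans ?_
    have hsum : ∀ i ∈ Finset.range p,
        ∫ x in S, ((2 * n : ℝ) * |logNorm T A (2 * n) (T^[i * n] x)| +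
          n * |logNorm T A n (T^[i * n] x)|) ∂μ ≤ 2 * n * w + n * w := by
      intro i _
      rw [integral_add ((hia _ h2nn _).const_mul _) ((hia _ le_rfl _).const_mul _),
        integral_const_mul, integral_const_mul]
      exact add_le_add (mul_le_mul_of_nonneg_left (hpart _ h2nn _) (by positivity))
        (mul_le_mul_of_nonneg_left (hpart _ le_rfl _) (by positivity))
    rw [integral_add' j12 j4, integral_add j1 j2, integral_finsetSum _ fun i _ => j3 i,
      integral_const_mul, integral_const_mul]
    have h1 := Finset.sum_le_card_nsmul _ _ _ hsum
    rw [Finset.card_range, nsmul_eq_mul] at h1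
    have h2 : ((p + 1) * n : ℝ) * ∫ x in S, |logNorm T A ((p + 1) * n) x| ∂μ ≤ (p + 1) * n * w :=
      mul_le_mul_of_nonneg_left (hpart _ hpnn 0) (by positivity)
    have h3 : (n : ℝ) * ∫ x in S, |logNorm T A n x| ∂μ ≤ n * w :=
      mul_le_mul_of_nonneg_left (hpart _ le_rfl 0) (by positivity)
    have h4 : 0 ≤ n * w := by positivity
    linarith
  have htot : |((p + 1) * n : ℝ) * d - n * a - p * (2 * n * b - n * a)| ≤
      16 * Q + 4 * n * (4 * K + 3 * e) := by
    rw [← hΦ]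
    refine abs_integral_le_integral_abs.trans ?_
    rw [← integral_add_compl hSm hΦint.abs]
    have : 4 * (p + 1) * n * w = 4 * n * (4 * K + 3 * e) := by rw [hw]; field_simp
    linarith
  have ha' := h.abs_meanLog_le hTm hA hn
  have hb' := h.abs_meanLog_le hTm hA hn2
  rw [← ha] at ha'
  rw [← hb] at hb'
  rw [le_div_iff₀ hp0]
  have hfac : n * (|d + a - 2 * b| * (p + 1)) ≤ n * (16 * Q + 20 * K + 12 * e) := by
    have e1 : n * (|d + a - 2 * b| * (p + 1)) = |n * (p + 1) * (d + a - 2 * b)| := by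
      rw [abs_mul, abs_of_nonneg (by positivity : (0 : ℝ) ≤ n * (p + 1))]; ring
    have e2 : n * (p + 1) * (d + a - 2 * b) =
        (((p + 1) * n : ℝ) * d - n * a - p * (2 * n * b - n * a)) + n * (2 * a - 2 * b) := by ring
    have e3 : |n * (2 * a - 2 * b)| ≤ n * (4 * K) := by
      rw [abs_mul, abs_of_pos hn0]
      refine mul_le_mul_of_nonneg_left ?_ hn0.le
      rw [abs_le] at ha' hb' ⊢
      constructor <;> linarith
    have e4 : 16 * Q ≤ n * (16 * Q) := le_mul_of_one_le_left (by positivity) hn1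
    rw [e1, e2]
    refine (abs_add_le _ _).trans ?_
    linarith
  exact le_of_mul_le_mul_left hfac hn0

/-- The comparison of scales for an arbitrary integer `n₁ ≥ n`, by sandwiching it between two
consecutive multiples of `n`. -/
lemma abs_meanLog_step_le [IsProbabilityMeasure μ] {K : ℝ≥0} (h : LogBound μ T A K)
    (hT : MeasurePreserving T μ μ) (hA : ∀ i j, Measurable fun x => A x i j) (hm : 2 ≤ m)
    (hwm : ∀ n, Measurable fun x => opNorm (wedge 2 (iter T A n x)))
    {n : ℕ} (hn : 1 ≤ n) {c e κ ε ι Q : ℝ} (he : 0 ≤ e) (hι : 0 ≤ ι)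
    (hκ : κ = (m : ℝ) ^ 3 * Real.exp (n * (c - 2 * (meanLog μ T A n - e))))
    (hε : ε = Real.exp (2 * n * (meanLog μ T A (2 * n) - meanLog μ T A n - 2 * e)))
    (hκε : κ ≤ ε ^ 2 / 100)
    (hdev : ∀ k, n ≤ k → μ {x | e < |logNorm T A k x - meanLog μ T A k|} ≤ ENNReal.ofReal ι)
    (hwdev : μ {x | Real.exp (n * c) < opNorm (wedge 2 (iter T A n x))} ≤ ENNReal.ofReal ι)
    {n₁ : ℕ} (hnn : n ≤ n₁) (hQ : 2 * (n₁ / n : ℝ) * (κ / ε ^ 2) ≤ Q)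
    (hpι : 2 * (n₁ / n : ℝ) * √ι ≤ 1) :
    |meanLog μ T A n₁ + meanLog μ T A n - 2 * meanLog μ T A (2 * n)|
      ≤ (2 * (16 * Q + 20 * K + 12 * e) + 2 * K) * (n / n₁) := by
  have hTm := hT.measurable
  have hK : (0 : ℝ) ≤ K := K.2
  have hn₁ : 1 ≤ n₁ := hn.trans hnn
  have hn0 : (0 : ℝ) < n := by exact_mod_cast hn
  have hn₁0 : (0 : ℝ) < n₁ := by exact_mod_cast hn₁
  have hκ0 : 0 ≤ κ / ε ^ 2 := by
    have : 0 ≤ κ := by rw [hκ]; positivity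
    positivity
  have hQ0 : 0 ≤ Q := le_trans (by positivity) hQ
  obtain ⟨p, r, hr, hpr⟩ : ∃ p r, r < n ∧ n₁ = (p + 1) * n + r := by
    refine ⟨n₁ / n - 1, n₁ % n, Nat.mod_lt _ hn, ?_⟩
    have h1 : 1 ≤ n₁ / n := (Nat.one_le_div_iff hn).2 hnn
    rw [Nat.sub_add_cancel h1, mul_comm]
    exact (Nat.div_add_mod n₁ n).symm
  have hprR : (n₁ : ℝ) = (p + 1) * n + r := by rw [hpr]; push_cast; ring
  have hrR : (r : ℝ) ≤ n := by exact_mod_cast hr.le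
  have hrn0 : (0 : ℝ) ≤ r := Nat.cast_nonneg r
  have hp0 : (0 : ℝ) ≤ p := Nat.cast_nonneg p
  have hcnt : ((p : ℝ) + 1) + 1 ≤ 2 * (n₁ / n : ℝ) := by
    have h1 : (p : ℝ) + 1 ≤ n₁ / n := by rw [le_div_iff₀ hn0]; linarith
    linarith
  have hpush : (((p + 1 : ℕ) : ℝ)) = (p : ℝ) + 1 := by push_cast; ring
  have hcnt' : (p : ℝ) + 1 ≤ 2 * (n₁ / n : ℝ) := by linarith
  have b1 := abs_meanLog_block_le h hT hA hm hwm hn p (Q := Q) he hι hκ hε hκε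
    ((mul_le_mul_of_nonneg_right hcnt' hκ0).trans hQ)
    ((mul_le_mul_of_nonneg_right hcnt' (Real.sqrt_nonneg _)).trans hpι) hdev hwdev
  have b2 := abs_meanLog_block_le h hT hA hm hwm hn (p + 1) (Q := Q) he hι hκ hε hκε
    (by rw [hpush]; exact (mul_le_mul_of_nonneg_right hcnt hκ0).trans hQ)
    (by rw [hpush]; exact (mul_le_mul_of_nonneg_right hcnt (Real.sqrt_nonneg _)).trans hpι)
    hdev hwdev
  rw [hpush] at b2
  set D := 16 * Q + 20 * K + 12 * e with hD
  have hD0 : 0 ≤ D := by positivity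
  have hratio : 1 / ((p : ℝ) + 1) ≤ 2 * (n / n₁) := by
    rw [← mul_div_assoc, div_le_div_iff₀ (by positivity) hn₁0]
    nlinarith
  have b1' : D / ((p : ℝ) + 1) ≤ 2 * D * (n / n₁) := by
    have := mul_le_mul_of_nonneg_left hratio hD0
    rw [mul_one_div] at this
    linarith
  have b2' : D / ((p : ℝ) + 1 + 1) ≤ 2 * D * (n / n₁) :=
    le_trans (by gcongr; linarith) b1'
  have hbound : ∀ s : ℕ, (s : ℝ) ≤ n → s * meanLog μ T A s ≤ n * K := by
    intro s hs
    rcases Nat.eq_zero_or_pos s with rfl | hs0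
    · simp; positivity
    · have h1 := (abs_le.1 (h.abs_meanLog_le hTm hA hs0)).2
      calc s * meanLog μ T A s ≤ s * K := by gcongr
        _ ≤ n * K := by gcongr
  have hsub := h.subadditive hT hA
  have u1 := hsub ((p + 1) * n) r
  have u2 := hsub n₁ (n - r)
  have hnext : n₁ + (n - r) = (p + 1 + 1) * n := by
    have : (p + 1 + 1) * n = (p + 1) * n + n := by ring
    omega
  dsimp only at u1 u2
  rw [← hpr] at u1
  rw [hnext] at u2
  set x := meanLog μ T A ((p + 1) * n) with hx
  set y := meanLog μ T A ((p + 1 + 1) * n) with hy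
  set z := meanLog μ T A n₁ with hz
  have hxK := (abs_le.1 (h.abs_meanLog_le hTm hA (n := (p + 1) * n)
    (Nat.mul_pos (Nat.succ_pos p) hn))).1
  have hyK := (abs_le.1 (h.abs_meanLog_le hTm hA (n := (p + 1 + 1) * n)
    (Nat.mul_pos (Nat.succ_pos _) hn))).1
  have hsr : ((n - r : ℕ) : ℝ) = n - r := by rw [Nat.cast_sub hr.le]
  have v1 := hbound r hrR
  have v2 := hbound (n - r) (by rw [hsr]; linarith)
  have up : z ≤ x + 2 * K * (n / n₁) := by
    have h1 : n₁ * z ≤ n₁ * x + 2 * K * n := by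
      have e1 : (((p + 1) * n : ℕ) : ℝ) * x = n₁ * x - r * x := by rw [hprR]; push_cast; ring
      have e2 : r * (-x) ≤ n * K :=
        (mul_le_mul_of_nonneg_left (by linarith) hrn0).trans (mul_le_mul_of_nonneg_right hrR hK)
      linarith
    have h2 : x + 2 * K * (n / n₁) = (n₁ * x + 2 * K * n) / n₁ := by field_simp
    rw [h2, le_div_iff₀ hn₁0]
    linarith
  have lo : y ≤ z + 2 * K * (n / n₁) := by
    have h1 : n₁ * y ≤ n₁ * z + 2 * K * n := by
      have e1 : (((p + 1 + 1) * n : ℕ) : ℝ) * y = n₁ * y + (n - r) * y := by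
        rw [hprR]; push_cast; ring
      have e2 : (n - r) * (-y) ≤ n * K :=
        (mul_le_mul_of_nonneg_left (by linarith) (sub_nonneg.2 hrR)).trans
          (mul_le_mul_of_nonneg_right (by linarith) hK)
      linarith
    have h2 : z + 2 * K * (n / n₁) = (n₁ * z + 2 * K * n) / n₁ := by field_simp
    rw [h2, le_div_iff₀ hn₁0]
    linarith
  rw [abs_le] at b1 b2 ⊢
  constructor <;> linarith

end Induction

/-! ### The inductive step near a cocycle with a spectral gap -/

section SpectralGap

variable {X : Type*} [MeasurableSpace X] {μ : Measure X} {T : X → X}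

/-- A fiber-LDT estimate in terms of real functions. -/
lemma LogBound.measure_deviation_le [IsProbabilityMeasure μ] {m : ℕ}
    {A : X → Matrix (Fin m) (Fin m) ℝ} {K : ℝ≥0} (h : LogBound μ T A K) (hT : Measurable T)
    (hA : ∀ i j, Measurable fun x => A x i j) {n : ℕ} (hn : 1 ≤ n) {e d : ℝ} {r : ℝ≥0∞}
    (he : 0 < e) (hd : d ≤ e)
    (hdev : μ {x | ENNReal.ofReal d <
      (scaledLog n (opNorm (iter T A n x)) - finiteLE μ T A n).abs} < r) :
    μ {x | e < |logNorm T A n x - meanLog μ T A n|} ≤ r := by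
  refine le_trans (measure_mono_ae ?_) hdev.le
  filter_upwards [h.ae_scaledLog hT hA hn] with x hx hlt
  have hlt' : e < |logNorm T A n x - meanLog μ T A n| := hlt
  change ENNReal.ofReal d < (scaledLog n (opNorm (iter T A n x)) - finiteLE μ T A n).abs
  rw [hx, h.finiteLE_eq hT hA hn, ← EReal.coe_sub, EReal.abs_def,
    ENNReal.ofReal_lt_ofReal_iff (he.trans hlt')]
  exact hd.trans_lt hlt'

/-- The scale comparison, uniformly near a cocycle with a spectral gap. The function `f` is a large
multiple of the sum of the LDT measure functions of `‖B^{(n)}‖` and `‖∧₂ B^{(n)}‖`, which keeps the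
exceptional sets small, and of a function that dominates `e^{-2εt}`, which keeps the number of blocks
below the inverse `e^{εn₀}` of the error per block in the avalanche principle. -/
lemma exists_uniform_step [IsProbabilityMeasure μ] (hT : MeasurePreserving T μ μ)
    (C : CocycleSpace μ) {Ξ : Set (X → ℝ)} (P : LDTSystem)
    (hI : ∀ c : ℝ, 0 < c → ∃ f ∈ P.measures, ∀ᶠ t : ℝ in atTop, Real.exp (-(c * t)) ≤ f t)
    (hcompat : ∀ m, ∀ A : C.Dim m, Compatible μ T Ξ A.fn) (hbase : ∀ ξ ∈ Ξ, BaseLDT μ T P ξ)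
    {m : ℕ} (hm : 2 ≤ m) (A : C.Dim m) (hfiber : UniformFiberLDT T P A) {κ : ℝ}
    (hκ : IsGap μ T A.fn κ) {δ₀ : ℝ} (hδ₀ : 0 < δ₀) {K : ℝ≥0}
    (hK : ∀ B : C.Dim m, dist B A < δ₀ → LogBound μ T B.fn K) {ε : ℝ} (hε : 0 < ε) :
    ∃ δ : ℝ, 0 < δ ∧ δ ≤ δ₀ ∧ ∃ n₀₀ : ℕ, 1 ≤ n₀₀ ∧ ∃ f ∈ P.measures,
      ∀ n₀ : ℕ, n₀₀ ≤ n₀ → ∀ B : C.Dim m, dist B A < δ → ∀ η₀ θ₀ : ℝ,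
        meanLog μ T B.fn n₀ - meanLog μ T B.fn (2 * n₀) < η₀ →
        |meanLog μ T B.fn n₀ - meanLog μ T A.fn n₀| < θ₀ →
        4 * η₀ + 2 * θ₀ < κ - 12 * ε → ∀ n₁ : ℕ, n₀ ≤ n₁ →
        (n₁ : ℝ) ≤ 2 * (n₀ * f n₀ ^ (-(1 / 2) : ℝ)) →
        |meanLog μ T B.fn n₁ + meanLog μ T B.fn n₀ - 2 * meanLog μ T B.fn (2 * n₀)|
          ≤ (2 * (16 * (m : ℝ) ^ 3 + 20 * K + 12 * ε) + 2 * K) * (n₀ / n₁) := by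
  have hTm := hT.measurable
  have hmeas : ∀ B : C.Dim m, ∀ i j, Measurable fun x => B.fn x i j :=
    fun B => C.measurable_entries m B.1 B.2
  have hKA := hK A (by simpa using hδ₀)
  obtain ⟨L, hL1, hL, hLle⟩ := hKA.exists_limit hT (hmeas A) (by omega)
  -- the second exterior power
  let Φ : C.Dim m → C.Dim (m.choose 2) :=
    fun B => ⟨fun x => wedge 2 (B.1 x), C.wedge_mem m B.1 B.2 2 one_le_two hm⟩
  have hΦ : Continuous Φ :=
    @LocallyLipschitz.continuous (C.carrier m) (C.carrier (m.choose 2))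
      (C.metric m).toPseudoEMetricSpace (C.metric (m.choose 2)).toPseudoEMetricSpace _
      (C.wedge_locallyLipschitz m 2 one_le_two hm)
  have hwm : ∀ (B : C.Dim m) n, Measurable fun x => opNorm (wedge 2 (iter T B.fn n x)) := by
    intro B n
    have h1 : Measurable fun x => opNorm (iter T (fun x => wedge 2 (B.fn x)) n x) :=
      measurable_opNorm_iter hTm (C.measurable_entries _ (Φ B).1 (Φ B).2) n
    simpa only [iter_wedge] using h1
  obtain ⟨M, -, hM⟩ := ae_opNorm_le A
  obtain ⟨N, hN, l, hl, hAl, hlc⟩ :=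
    exists_wedge_majorant hKA hT (hmeas A) hm hM (hwm A) hL hL1 hκ hε
  obtain ⟨δ₁, hδ₁, n₁', f₁, hf₁, hdev₁⟩ :=
    exists_upper_deviation hT hbase (Φ A) (hcompat _ _) hN hl hAl hlc
  obtain ⟨δ₂, hδ₂, hΦδ⟩ := Metric.continuous_iff.1 hΦ A δ₁ hδ₁
  obtain ⟨δ₃, hδ₃, p, hp, hdev₂⟩ := hfiber ε hε
  obtain ⟨f₂, hf₂, hexp⟩ := hI (2 * ε) (by positivity)
  obtain ⟨t₀, ht₀⟩ := eventually_atTop.1 hexp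
  have hmes := P.isDeviationMeasure _ (P.mes_mem p hp)
  have hmes₁ := P.isDeviationMeasure _ hf₁
  -- the scale from which on the avalanche principle applies
  have hlarge : ∀ᶠ n : ℕ in atTop, (m : ℝ) ^ 3 * Real.exp (-(ε * n)) < 1 / 100 := by
    have h1 : Tendsto (fun n : ℕ => (m : ℝ) ^ 3 * Real.exp (-(ε * n))) atTop
        (𝓝 ((m : ℝ) ^ 3 * 0)) := by
      refine Tendsto.const_mul _ (Real.tendsto_exp_neg_atTop_nhds_zero.comp ?_)
      exact tendsto_natCast_atTop_atTop.const_mul_atTop hε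
    rw [mul_zero] at h1
    exact h1.eventually (gt_mem_nhds (by norm_num))
  obtain ⟨n₂, hn₂⟩ := eventually_atTop.1 hlarge
  refine ⟨min δ₀ (min δ₂ δ₃), by positivity, min_le_left _ _,
    max 1 (max n₁' (max p.scale (max n₂ ⌈t₀⌉₊))), le_max_left _ _, _,
    P.smul_mem 16 (by norm_num) _ (P.add_mem _ (P.add_mem _ (P.mes_mem p hp) _ hf₁) _ hf₂), ?_⟩
  intro n₀ hn B hB η₀ θ₀ hη hθ hgap n₁ hnn hn₁
  simp only [max_le_iff, Nat.ceil_le] at hn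
  obtain ⟨hn1, hnn1, hnp, hnn2, hnt⟩ := hn
  simp only [lt_min_iff] at hB
  obtain ⟨hB0, hB2, hB3⟩ := hB
  have hKB := hK B hB0
  have hn0 : (0 : ℝ) < n₀ := by exact_mod_cast hn1
  set ι := p.mes n₀ + f₁ n₀ + f₂ n₀ with hι
  have hpm0 := hmes.pos n₀ hn0
  have hf10 := hmes₁.pos n₀ hn0
  have hf2low := ht₀ n₀ hnt
  have hf20 : 0 < f₂ n₀ := (Real.exp_pos _).trans_le hf2low
  have hι0 : 0 < ι := by positivity
  have hrpow : (16 * ι) ^ (-(1 / 2) : ℝ) = (4 * √ι)⁻¹ := by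
    rw [Real.rpow_neg (by positivity), ← Real.sqrt_eq_rpow, Real.sqrt_mul (by norm_num)]
    congr 2
    rw [show (16 : ℝ) = 4 ^ 2 by norm_num, Real.sqrt_sq (by norm_num)]
  have hsι : 0 < √ι := Real.sqrt_pos.2 hι0
  have hcount : 2 * (n₁ / n₀ : ℝ) * √ι ≤ 1 := by
    have h1 : (n₁ : ℝ) ≤ 2 * (n₀ * (4 * √ι)⁻¹) := by rw [← hrpow]; exact hn₁
    have h2 : 2 * (n₀ * (4 * √ι)⁻¹) = n₀ / (2 * √ι) := by field_simp; norm_num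
    rw [h2, le_div_iff₀ (by positivity)] at h1
    rw [mul_div_assoc', div_mul_eq_mul_div, div_le_one hn0]
    linarith
  have hsqrt : Real.exp (-(ε * n₀)) ≤ √ι := by
    refine Real.le_sqrt_of_sq_le ?_
    rw [← Real.exp_nat_mul]
    have : ((2 : ℕ) : ℝ) * -(ε * n₀) = -(2 * ε * n₀) := by push_cast; ring
    rw [this]
    linarith
  set a := meanLog μ T B.fn n₀ with ha
  set b := meanLog μ T B.fn (2 * n₀) with hb
  set c := 2 * L - κ + ε with hc
  have hLa : L < a + θ₀ := by
    have h1 := hLle n₀ hn1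
    have h2 := (abs_lt.1 hθ).1
    linarith
  have hq : (m : ℝ) ^ 3 * Real.exp (n₀ * (c - 2 * (a - ε))) /
      Real.exp (2 * n₀ * (b - a - 2 * ε)) ^ 2 ≤ (m : ℝ) ^ 3 * Real.exp (-(ε * n₀)) := by
    rw [← Real.exp_nat_mul, mul_div_assoc, ← Real.exp_sub]
    refine mul_le_mul_of_nonneg_left (Real.exp_le_exp.2 ?_) (by positivity)
    have h1 : c - 2 * (a - ε) - 4 * (b - a - 2 * ε) ≤ -ε := by rw [hc]; linarith
    have h2 := mul_le_mul_of_nonneg_left h1 hn0.le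
    push_cast
    linarith
  have hdevB : ∀ k, n₀ ≤ k →
      μ {x | ε < |logNorm T B.fn k x - meanLog μ T B.fn k|} ≤ ENNReal.ofReal ι := by
    intro k hk
    obtain ⟨h1, h2⟩ := hdev₂ B hB3 k (hnp.trans hk)
    refine (hKB.measure_deviation_le hTm (hmeas B) (hn1.trans hk) hε h1 h2).trans
      (ENNReal.ofReal_le_ofReal ?_)
    have h3 : p.mes k ≤ p.mes n₀ := by
      refine hmes.strictAntiOn.antitoneOn hn0 (hn0.trans_le ?_) ?_ <;> exact_mod_cast hk
    linarith
  have hwdevB : μ {x | Real.exp (n₀ * c) < opNorm (wedge 2 (iter T B.fn n₀ x))} ≤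
      ENNReal.ofReal ι := by
    have h1 := hdev₁ (Φ B) (hΦδ B hB2) n₀ hnn1
    have h2 : ∀ x, iter T (Φ B).fn n₀ x = wedge 2 (iter T B.fn n₀ x) := fun x => iter_wedge 2 n₀ x
    simp only [h2] at h1
    exact h1.trans (ENNReal.ofReal_le_ofReal (by linarith))
  refine abs_meanLog_step_le hKB hT (hmeas B) hm (hwm B) hn1 hε.le hι0.le rfl rfl ?_ hdevB hwdevB
    hnn ?_ hcount
  · have hq' := hq.trans (hn₂ n₀ hnn2).le
    rw [div_le_iff₀ (by positivity)] at hq'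
    linarith
  · have h1 : 0 ≤ 2 * (n₁ / n₀ : ℝ) := by positivity
    refine (mul_le_mul_of_nonneg_left hq h1).trans ?_
    have h2 := mul_le_mul_of_nonneg_left hsqrt h1
    calc 2 * (n₁ / n₀ : ℝ) * ((m : ℝ) ^ 3 * Real.exp (-(ε * n₀)))
        = (m : ℝ) ^ 3 * (2 * (n₁ / n₀ : ℝ) * Real.exp (-(ε * n₀))) := by ring
      _ ≤ (m : ℝ) ^ 3 * 1 := mul_le_mul_of_nonneg_left (h2.trans hcount) (by positivity)
      _ = (m : ℝ) ^ 3 := mul_one _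

end SpectralGap

end LinearCocycle

theorem proposition4p3 {X : Type*} [MeasurableSpace X] (μ : MeasureTheory.Measure X)
    [MeasureTheory.IsProbabilityMeasure μ] (T : X → X) (hT : Ergodic T μ)
    (C : LinearCocycle.CocycleSpace μ) (Ξ : Set (X → ℝ)) (P : LinearCocycle.LDTSystem)
    -- observables are measurable, with a finite integral
    (hΞ : ∀ ξ ∈ Ξ, Measurable ξ ∧ MeasureTheory.Integrable ξ μ)
    -- the convex cone of measure functions contains functions that decay at least as slowly as any
    -- given exponential
    (hI : ∀ c : ℝ, 0 < c → ∃ f ∈ P.measures, ∀ᶠ t : ℝ in Filter.atTop, Real.exp (-(c * t)) ≤ f t)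
    -- the standing assumptions
    (hcompat : ∀ m, ∀ A : C.Dim m, LinearCocycle.Compatible μ T Ξ A.fn)
    (hbase : ∀ ξ ∈ Ξ, LinearCocycle.BaseLDT μ T P ξ)
    (hbdd : ∀ m, ∀ A : C.Dim m, LinearCocycle.lyapunov μ T A.fn 1 ≠ ⊥ →
      LinearCocycle.UniformlyLpBounded T 2 A)
    (hfiber : ∀ m, 2 ≤ m → ∀ A : C.Dim m,
      LinearCocycle.lyapunov μ T A.fn 2 < LinearCocycle.lyapunov μ T A.fn 1 →
      LinearCocycle.UniformFiberLDT T P A)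
    (m : ℕ) (hm : 2 ≤ m) (A : C.Dim m) (κ : ℝ) (hκ : LinearCocycle.IsGap μ T A.fn κ) :
    ∃ K : ℝ, 0 < K ∧ ∀ ε : ℝ, 0 < ε → ε < κ / 20 →
      ∃ δ : ℝ, 0 < δ ∧ ∃ n₀₀ : ℕ, ∃ mes ∈ P.measures,
        -- the finite scale exponents are finite near `A`
        (∀ B : C.Dim m, dist B A < δ → ∀ n : ℕ, 1 ≤ n →
          LinearCocycle.finiteLE μ T B.fn n ≠ ⊥ ∧ LinearCocycle.finiteLE μ T B.fn n ≠ ⊤) ∧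
        ∀ n₀ : ℕ, n₀₀ ≤ n₀ → ∀ B : C.Dim m, dist B A < δ → ∀ η₀ θ₀ : ℝ, 0 < η₀ → 0 < θ₀ →
          LinearCocycle.realLE T B n₀ - LinearCocycle.realLE T B (2 * n₀) < η₀ →
          |LinearCocycle.realLE T B n₀ - LinearCocycle.realLE T A n₀| < θ₀ →
          4 * η₀ + 2 * θ₀ < κ - 12 * ε →
          ∀ a : ℝ, 0 < a → ∀ n₁ : ℕ, (n₀ : ℝ) ^ (1 + a) ≤ n₁ →
            (n₁ : ℝ) ≤ n₀ * mes n₀ ^ (-(1 / 2) : ℝ) →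
            |LinearCocycle.realLE T B n₁ + LinearCocycle.realLE T B n₀
              - 2 * LinearCocycle.realLE T B (2 * n₀)| < K * (n₀ / n₁) ∧
            LinearCocycle.realLE T B n₁ - LinearCocycle.realLE T B (2 * n₁) < K * (n₀ / n₁) ∧
            -- the comparison with `A` uses the first inequality for `A` too
            (LinearCocycle.realLE T A n₀ - LinearCocycle.realLE T A (2 * n₀) < η₀ →
              |LinearCocycle.realLE T B n₁ - LinearCocycle.realLE T A n₁|
                < θ₀ + 4 * η₀ + K * (n₀ / n₁)) := by
  have hTp := hT.toMeasurePreserving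
  have hTm := hTp.measurable
  have hmeas : ∀ B : C.Dim m, ∀ i j, Measurable fun x => B.fn x i j :=
    fun B => C.measurable_entries m B.1 B.2
  have hκ0 : 0 < κ := hκ.2.1
  obtain ⟨δ₀, hδ₀, K, hK⟩ := hbdd m A (bot_le.trans_lt hκ.1).ne'
  set Q : ℝ := (m : ℝ) ^ 3 with hQ
  have hK0 : (0 : ℝ) ≤ K := K.2
  -- the constant of the scale comparison, made independent of `ε` by means of `ε < κ`
  set D : ℝ := 2 * (16 * Q + 20 * K + 12 * κ) + 2 * K with hD
  have hD0 : 0 < D := by positivity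
  refine ⟨3 * D, by positivity, fun ε hε hεκ => ?_⟩
  obtain ⟨δ, hδ, hδδ, n₀₀, hn₀₀, f, hf, hstep⟩ :=
    LinearCocycle.exists_uniform_step hTp C P hI hcompat hbase hm A (hfiber m hm A hκ.1) hκ hδ₀ hK hε
  have hreal : ∀ B : C.Dim m, dist B A < δ → ∀ n, 1 ≤ n →
      LinearCocycle.finiteLE μ T B.fn n = (LinearCocycle.meanLog μ T B.fn n : EReal) :=
    fun B hB n hn => LinearCocycle.LogBound.finiteLE_eq (hK B (hB.trans_le hδδ)) hTm (hmeas B) hn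
  have hrealLE : ∀ B : C.Dim m, dist B A < δ → ∀ n, 1 ≤ n →
      LinearCocycle.realLE T B n = LinearCocycle.meanLog μ T B.fn n := fun B hB n hn => by
    rw [LinearCocycle.realLE, hreal B hB n hn, EReal.toReal_coe]
  refine ⟨δ, hδ, n₀₀, f, hf, fun B hB n hn => ?_, ?_⟩
  · rw [hreal B hB n hn]
    exact ⟨EReal.coe_ne_bot _, EReal.coe_ne_top _⟩
  intro n₀ hn B hB η₀ θ₀ hη₀ hθ₀ hη hθ hgap a ha n₁ hlow hup
  have hn1 : 1 ≤ n₀ := hn₀₀.trans hn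
  have hn0 : (1 : ℝ) ≤ n₀ := by exact_mod_cast hn1
  have hA : dist A A < δ := by simpa using hδ
  have hnn : n₀ ≤ n₁ := by
    have : (n₀ : ℝ) ≤ n₁ := (Real.self_le_rpow_of_one_le hn0 (by linarith)).trans hlow
    exact_mod_cast this
  have hn₁1 : 1 ≤ n₁ := hn1.trans hnn
  rw [hrealLE B hB n₀ hn1, hrealLE A hA n₀ hn1] at hθ
  rw [hrealLE B hB n₀ hn1, hrealLE B hB (2 * n₀) (by omega)] at hη
  rw [hrealLE B hB n₀ hn1, hrealLE B hB (2 * n₀) (by omega), hrealLE B hB n₁ hn₁1,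
    hrealLE B hB (2 * n₁) (by omega), hrealLE A hA n₁ hn₁1, hrealLE A hA n₀ hn1,
    hrealLE A hA (2 * n₀) (by omega)]
  have hn₁0 : (0 : ℝ) < n₁ := by exact_mod_cast hn₁1
  set r : ℝ := n₀ / n₁ with hr
  have hr0 : 0 < r := by positivity
  have hDr : 0 < D * r := mul_pos hD0 hr0
  have hconst : ∀ s : ℝ, 0 ≤ s →
      (2 * (16 * Q + 20 * K + 12 * ε) + 2 * K) * s ≤ D * s := fun s hs => by
    refine mul_le_mul_of_nonneg_right ?_ hs
    rw [hD]; linarith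
  have hup' : (n₁ : ℝ) ≤ 2 * (n₀ * f n₀ ^ (-(1 / 2) : ℝ)) := by linarith
  have s1 := (hstep n₀ hn B hB η₀ θ₀ hη hθ hgap n₁ hnn hup').trans (hconst r hr0.le)
  have s2 := (hstep n₀ hn B hB η₀ θ₀ hη hθ hgap (2 * n₁) (by omega)
    (by push_cast; linarith)).trans (hconst _ (by positivity))
  have hr2 : (n₀ / (2 * n₁ : ℕ) : ℝ) = r / 2 := by rw [hr]; push_cast; field_simp
  rw [hr2] at s2
  refine ⟨lt_of_le_of_lt s1 (by linarith), ?_, fun hηA => ?_⟩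
  · have h1 := (abs_le.1 s1).2
    have h2 := (abs_le.1 s2).1
    linarith
  · have s3 := (hstep n₀ hn A hA η₀ θ₀ hηA (by simpa using hθ₀) hgap n₁ hnn hup').trans
      (hconst r hr0.le)
    have hmono : ∀ B : C.Dim m, dist B A < δ →
        LinearCocycle.meanLog μ T B.fn (2 * n₀) ≤ LinearCocycle.meanLog μ T B.fn n₀ := by
      intro B hB
      have h1 := LinearCocycle.LogBound.subadditive (hK B (hB.trans_le hδδ)) hTp (hmeas B) n₀ n₀
      rw [← two_mul] at h1
      push_cast at h1
      have h2 : (0 : ℝ) < 2 * n₀ := by linarith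
      refine le_of_mul_le_mul_left ?_ h2
      linarith
    have m1 := hmono B hB
    have m2 := hmono A hA
    rw [abs_le] at s1 s3
    rw [abs_lt] at hθ ⊢
    constructor <;> linarith
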